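/- Let $(X_i)_{i\ge 1}$ be independent and identically distributed real random variables with cumulative distribution function $F$, with order statistics $X_{1,n}\le\dots\le X_{n,n}$. Let $H=-\log(1-F)$ (with $H=+\infty$ where $F=1$) and $H^{\leftarrow}(t)=\inf\{x : H(x)\ge t\}$. Assume: (A.1) there are $\theta>0$ and a slowly varying function $\ell$ (that is, $\ell(\lambda t)/\ell(t)\to 1$ as $t\to\infty$ for every $\lambda>0$) such that $H^{\leftarrow}(t)=t^{\theta}\ell(t)$ for all $t>0$; (A.2) there are $\rho\le 0$ and a function $b$ with $b(t)\to 0$ as $t\to\infty$ such that $$\log\frac{\ell(\lambda t)}{\ell(t)}\sim b(t)\int_1^{\lambda}u^{\rho-1}\,du\qquad (t\to\infty),$$ uniformly locally on $\lambda>1$; that is, for all $\Lambda>1$ and $\varepsilon>0$ there is $T$ such that $$\left|\log\frac{\ell(\lambda t)}{\ell(t)}-b(t)\int_1^{\lambda}u^{\rho-1}\,du\right|\le\varepsilon\left|b(t)\int_1^{\lambda}u^{\rho-1}\,du\right|$$ for all $t\ge T$ and $1<\lambda\le\Lambda$. Let $(k_n)$ be an intermediate sequence of integers, that is, $k_n\to\infty$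 and $k_n/n\to 0$, such that $$k_n^{1/2}\max\{|b(\log n)|,\,1/\log n\}\to 0 .$$ Define the Hill-type estimator, with $\log_2 x=\log(\log x)$, by $$\hat\theta_n^{H}=\sum_{i=1}^{k_n-1}\bigl(\log X_{n-i+1,n}-\log X_{n-k_n+1,n}\bigr)\Big/\sum_{i=1}^{k_n-1}\bigl(\log_2(n/i)-\log_2(n/k_n)\bigr).$$ Then $k_n^{1/2}(\hat\theta_n^{H}-\theta)$ converges in distribution to $\mathcal N(0,\theta^2)$ as $n\to\infty$. -/

import Mathlib

open Filter Topology MeasureTheory ProbabilityTheory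

noncomputable section

namespace WeibullTail

/-- The function `H = -log (1 - F)`, with values in the extended reals: it is `⊤` where `F = 1`. -/
def failureRate (F : ℝ → ℝ) (x : ℝ) : EReal :=
  -ENNReal.log (ENNReal.ofReal (1 - F x))

/-- The generalized inverse `H^←(t) = inf {x | H x ≥ t}`. For `t > 0` and a cumulative distribution
function `F`, the set is nonempty and bounded below. -/
def invFailureRate (F : ℝ → ℝ) (t : ℝ) : ℝ :=
  sInf {x : ℝ | (t : EReal) ≤ failureRate F x}

/-- `ℓ` is slowly varying at infinity. -/
def SlowlyVarying (ℓ : ℝ → ℝ) : Prop :=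
  ∀ s : ℝ, 0 < s → Tendsto (fun t : ℝ => ℓ (s * t) / ℓ t) atTop (𝓝 1)

/-- `K_ρ(s) = ∫_1^s u^(ρ-1) du`. -/
def kernelK (ρ s : ℝ) : ℝ :=
  ∫ u in (1 : ℝ)..s, u ^ (ρ - 1)

/-- The first order condition: `H^←(t) = t^θ ℓ(t)` for `t > 0`, with `ℓ` slowly varying. -/
structure FirstOrder (F : ℝ → ℝ) (θ : ℝ) (ℓ : ℝ → ℝ) : Prop where
  eq : ∀ t : ℝ, 0 < t → invFailureRate F t = t ^ θ * ℓ t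
  slow : SlowlyVarying ℓ

/-- The second order condition: `ρ ≤ 0`, `b(t) → 0`, and
`log (ℓ(s t) / ℓ(t)) ~ b(t) K_ρ(s)` as `t → ∞`, uniformly over `1 < s ≤ Λ`, for every `Λ > 1`.
The equivalence `u ~ v` means `u = (1 + o(1)) v`, so `b` may vanish. -/
structure SecondOrder (ℓ b : ℝ → ℝ) (ρ : ℝ) : Prop where
  nonpos : ρ ≤ 0
  lim : Tendsto b atTop (𝓝 0)
  equiv : ∀ Λ : ℝ, 1 < Λ → ∀ ε : ℝ, 0 < ε → ∃ T : ℝ, ∀ t : ℝ, T ≤ t → ∀ s : ℝ, 1 < s → s ≤ Λ →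
    |Real.log (ℓ (s * t) / ℓ t) - b t * kernelK ρ s| ≤ ε * |b t * kernelK ρ s|

/-- The order statistic `x_{j,n}`, for `1 ≤ j ≤ n`: the `j`-th smallest of the values
`x 0, …, x (n-1)`, counted with multiplicity (and `0` for other `j`). -/
def orderStat (x : ℕ → ℝ) (n j : ℕ) : ℝ :=
  if h : 1 ≤ j ∧ j ≤ n then
    let v : Fin n → ℝ := fun i => x i
    v (Tuple.sort v ⟨j - 1, by omega⟩)
  else 0

/-- The iterated logarithm `log₂ x = log (log x)`. -/
def log₂ (x : ℝ) : ℝ :=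
  Real.log (Real.log x)

/-- The Hill-type estimator computed from the `k` largest among `x 0, …, x (n-1)`. -/
def hillEstimator (x : ℕ → ℝ) (n k : ℕ) : ℝ :=
  (∑ i ∈ Finset.Icc 1 (k - 1),
      (Real.log (orderStat x n (n - i + 1)) - Real.log (orderStat x n (n - k + 1)))) /
    ∑ i ∈ Finset.Icc 1 (k - 1), (log₂ ((n : ℝ) / i) - log₂ ((n : ℝ) / k))

end WeibullTail

end

/-!
The sample is replaced by `X = H^←(E)` with `E` standard exponential, which does not change the law
of the estimator (`map_invFailureRate_expMeasure`). Since `H^←` is nondecreasing, the order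
statistics of `X` are the images of those of `E`.

Write `k = m + 1`. By symmetry and the lack of memory of the exponential law, the pivot `T`, which
is the `k`-th largest of the `n` exponential variables, and the `m` excesses `f j` of the larger
ones over it may be treated as independent, the excesses being standard exponential
(`exists_law_pivot`). The symmetry argument avoids the joint density of the order statistics: for a
sample without ties, the number of permutations bringing it into the set where a prescribed
coordinate is the pivot and prescribed coordinates are the larger ones does not depend on the
sample, so that the integral of a symmetric function is a multiple of its integral over this set.

The numerator of the estimator is now the sum of `log H^←(T + f j) - log H^←(T)`. The second order
condition and a Taylor expansion of the logarithm turn it into `θ ∑ f j / T`, with relative error of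
order `|b(T)| + 1 / T` (`abs_pivotLogExcess_sub_le`). By Chebyshev's inequality for the number of
exceedances, `T` is within distance `1` of `log (n / k)` (`measure_pivot_le`), hence comparable
with `log n`, and the regular variation of `b` bounds `b(T)` by a multiple of `b(log n)`
(`SecondOrder.exists_abs_le_mul`). The denominator is `m / log (n / k)` up to a relative error
`o(1 / √k)` (`abs_mul_hillNorm_sub_le`). Hence `√k (θ̂ - θ)` differs from
`θ (∑ f j - m) / √m` by a term which tends to `0` in probability
(`tendstoInMeasure_estimator_sub`), and the central limit theorem for the `f j` concludes. All the
pivots and excesses are put on one probability space, as Slutsky's lemma requires; only the laws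
of the estimators matter.
-/

namespace WeibullTail

/-! ### The standard exponential law -/

instance isProbabilityMeasure_expMeasure_one : IsProbabilityMeasure (expMeasure 1) :=
  isProbabilityMeasure_expMeasure one_pos

instance nullSingletonClass_expMeasure_one : NullSingletonClass (expMeasure 1) := by
  unfold expMeasure gammaMeasure
  infer_instance

theorem expMeasure_Iic {t : ℝ} (ht : 0 ≤ t) :
    expMeasure 1 (Set.Iic t) = ENNReal.ofReal (1 - Real.exp (-t)) := by
  have h := cdf_expMeasure_eq one_pos t
  rw [cdf_eq_real, if_pos ht, one_mul] at h
  rw [← h, ofReal_measureReal]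

theorem expMeasure_Ioi {t : ℝ} (ht : 0 ≤ t) :
    expMeasure 1 (Set.Ioi t) = ENNReal.ofReal (Real.exp (-t)) := by
  rw [← Set.compl_Iic, prob_compl_eq_one_sub measurableSet_Iic, expMeasure_Iic ht,
    ← ENNReal.ofReal_one, ← ENNReal.ofReal_sub]
  · ring_nf
  · have : Real.exp (-t) ≤ 1 := Real.exp_le_one_iff.2 (by linarith)
    linarith

theorem ae_pos_expMeasure : ∀ᵐ x ∂expMeasure 1, 0 < x := by
  rw [ae_iff]
  have : {a : ℝ | ¬ 0 < a} = Set.Iic 0 := by ext; simp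
  rw [this, expMeasure_Iic le_rfl]
  simp

/-- The exponential law has no memory. -/
theorem map_sub_restrict_expMeasure {t : ℝ} (ht : 0 ≤ t) :
    ((expMeasure 1).restrict (Set.Ioi t)).map (fun x => x - t) =
      ENNReal.ofReal (Real.exp (-t)) • expMeasure 1 := by
  refine Measure.ext_of_Ici _ _ fun a => ?_
  rw [Measure.map_apply (by fun_prop) measurableSet_Ici, Measure.restrict_apply
    (measurableSet_Ici.preimage (by fun_prop)), Measure.smul_apply, smul_eq_mul]
  have h1 : (fun x => x - t) ⁻¹' Set.Ici a ∩ Set.Ioi t = Set.Ici (a + t) ∩ Set.Ioi t := by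
    ext x; simp
  have h2 : Set.Ioi (a + t) ∩ Set.Ioi t = Set.Ioi (max (a + t) t) := by
    ext x; simp
  have h3 : (Set.Ici (a + t) ∩ Set.Ioi t : Set ℝ) =ᵐ[expMeasure 1]
      (Set.Ioi (a + t) ∩ Set.Ioi t : Set ℝ) :=
    Ioi_ae_eq_Ici.symm.inter (ae_eq_refl _)
  rw [h1, measure_congr h3, h2, expMeasure_Ioi (by simp [ht]), ← measure_congr Ioi_ae_eq_Ici]
  rcases le_total 0 a with ha | ha
  · rw [expMeasure_Ioi ha, ← ENNReal.ofReal_mul (Real.exp_pos _).le, ← Real.exp_add,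
      max_eq_left (by linarith)]
    ring_nf
  · have : expMeasure 1 (Set.Ioi a) = 1 := by
      refine (prob_compl_eq_zero_iff measurableSet_Ioi).1 ?_
      refine measure_mono_null ?_ (ae_iff.1 ae_pos_expMeasure)
      intro x hx
      simp only [Set.compl_Ioi, Set.mem_Iic] at hx
      simp only [not_lt, Set.mem_ofPred_eq]
      linarith
    rw [this, max_eq_right (by linarith), mul_one]

theorem lintegral_expMeasure {f : ℝ → ENNReal} :
    ∫⁻ x, f x ∂expMeasure 1 = ∫⁻ x in Set.Ioi 0, ENNReal.ofReal (Real.exp (-x)) * f x := by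
  have h1 : expMeasure 1 = (volume : Measure ℝ).withDensity (exponentialPDF 1) := rfl
  have hm : Measurable (exponentialPDF 1) := (measurable_exponentialPDFReal 1).ennreal_ofReal
  rw [h1, lintegral_withDensity_eq_lintegral_mul_non_measurable _ hm
    (by simp [exponentialPDF])]
  rw [← lintegral_add_compl _ (measurableSet_Ioi (a := (0:ℝ)))]
  have h2 : ∫⁻ a in (Set.Ioi (0:ℝ))ᶜ, (exponentialPDF 1 * f) a = 0 := by
    rw [Set.compl_Ioi, setLIntegral_congr Iio_ae_eq_Iic.symm]
    refine (setLIntegral_congr_fun measurableSet_Iio (g := fun _ => 0) ?_).trans (by simp)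
    intro x hx
    simp [exponentialPDF_of_neg hx]
  rw [h2, add_zero]
  refine setLIntegral_congr_fun measurableSet_Ioi ?_
  intro x hx
  simp [exponentialPDF_of_nonneg (le_of_lt hx)]

theorem lintegral_pow_expMeasure (p : ℕ) :
    ∫⁻ x, ENNReal.ofReal (x ^ p) ∂expMeasure 1 = ENNReal.ofReal (p.factorial) := by
  rw [lintegral_expMeasure, ← Real.Gamma_nat_eq_factorial, Real.Gamma_eq_integral (by positivity),
    ofReal_integral_eq_lintegral_ofReal (Real.GammaIntegral_convergent (by positivity))]
  · refine setLIntegral_congr_fun measurableSet_Ioi fun x hx => ?_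
    simp only [add_sub_cancel_right, Real.rpow_natCast]
    rw [ENNReal.ofReal_mul (Real.exp_pos _).le]
  · filter_upwards [self_mem_ae_restrict measurableSet_Ioi] with x hx
    have : (0:ℝ) < x := hx
    simp only [Pi.zero_apply]
    positivity

theorem integrable_pow_expMeasure (p : ℕ) : Integrable (fun x : ℝ => x ^ p) (expMeasure 1) := by
  refine ⟨by fun_prop, ?_⟩
  rw [hasFiniteIntegral_iff_ofReal]
  · rw [lintegral_pow_expMeasure]; exact ENNReal.ofReal_lt_top
  · filter_upwards [ae_pos_expMeasure] with x hx
    simp only [Pi.zero_apply]; positivity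

theorem integral_pow_expMeasure (p : ℕ) : ∫ x, x ^ p ∂expMeasure 1 = p.factorial := by
  rw [integral_eq_lintegral_of_nonneg_ae _ (by fun_prop), lintegral_pow_expMeasure,
    ENNReal.toReal_ofReal (by positivity)]
  filter_upwards [ae_pos_expMeasure] with x hx
  simp only [Pi.zero_apply]; positivity

theorem integral_id_expMeasure : ∫ x, x ∂expMeasure 1 = 1 := by
  simpa using integral_pow_expMeasure 1

theorem variance_id_expMeasure : Var[id; expMeasure 1] = 1 := by
  rw [variance_eq_sub]
  · have h2 := integral_pow_expMeasure 2
    simp only [Pi.pow_apply, id, h2, integral_id_expMeasure]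
    norm_num [Nat.factorial]
  · refine (memLp_two_iff_integrable_sq (by fun_prop)).2 ?_
    simpa using integrable_pow_expMeasure 2

/-! ### Symmetric functions of an independent sample -/

/-- Glues a pivot `t`, values `y` meant to lie above it and values `z` meant to lie below it into a
single sample, the positions being prescribed by `e`. -/
def glue {m r n : ℕ} (e : Unit ⊕ (Fin m ⊕ Fin r) ≃ Fin n)
    (p : ℝ × ((Fin m → ℝ) × (Fin r → ℝ))) : Fin n → ℝ :=
  fun i => Sum.elim (fun _ => p.1) (Sum.elim p.2.1 p.2.2) (e.symm i)

/-- The samples with positive entries whose entries at the positions of the second kind exceed the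
pivot, those of the third kind being smaller than the pivot. -/
def pivotSet {m r n : ℕ} (e : Unit ⊕ (Fin m ⊕ Fin r) ≃ Fin n) : Set (Fin n → ℝ) :=
  {x | (∀ i, 0 < x i) ∧ (∀ j, x (e (.inl ())) < x (e (.inr (.inl j)))) ∧
    ∀ l, x (e (.inr (.inr l))) < x (e (.inl ()))}

section

variable {m r n : ℕ}

theorem measurable_glue (e : Unit ⊕ (Fin m ⊕ Fin r) ≃ Fin n) : Measurable (glue e) := by
  refine measurable_pi_lambda _ fun i => ?_
  unfold glue
  rcases h : e.symm i with u | j | l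
  · simp only [Sum.elim_inl]; fun_prop
  · simp only [Sum.elim_inr, Sum.elim_inl]; fun_prop
  · simp only [Sum.elim_inr]; fun_prop

theorem measurableSet_pivotSet (e : Unit ⊕ (Fin m ⊕ Fin r) ≃ Fin n) :
    MeasurableSet (pivotSet e) := by
  unfold pivotSet
  refine .inter (Measurable.setOf <| Measurable.forall fun i => ?_)
    (.inter (Measurable.setOf <| Measurable.forall fun i => ?_)
      (Measurable.setOf <| Measurable.forall fun i => ?_)) <;>
  exact measurableSet_setOfPred.1 (measurableSet_lt (by fun_prop) (by fun_prop))

/-- Gluing independent samples of the same law gives an independent sample. -/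
theorem measurePreserving_glue (μ : Measure ℝ) [IsProbabilityMeasure μ]
    (e : Unit ⊕ (Fin m ⊕ Fin r) ≃ Fin n) :
    MeasurePreserving (glue e)
      (μ.prod ((Measure.pi fun _ => μ).prod (Measure.pi fun _ => μ)))
      (Measure.pi fun _ : Fin n => μ) := by
  refine ⟨measurable_glue e, (Measure.pi_eq fun s hs => ?_).symm⟩
  rw [Measure.map_apply (measurable_glue e) (.univ_pi hs)]
  have : glue e ⁻¹' Set.univ.pi s = s (e (.inl ())) ×ˢ
      ((Set.univ.pi fun j => s (e (.inr (.inl j)))) ×ˢ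
        (Set.univ.pi fun l => s (e (.inr (.inr l))))) := by
    ext p
    simp only [Set.mem_preimage, Set.mem_pi, Set.mem_univ, true_imp_iff, Set.mem_prod]
    rw [← e.forall_congr_right]
    simp [glue, Sum.forall, Unique.forall_iff]
  rw [this, Measure.prod_prod, Measure.prod_prod, Measure.pi_pi, Measure.pi_pi,
    ← e.prod_comp, Fintype.prod_sum_type, Fintype.prod_sum_type]
  simp

theorem ae_injective_pi (μ : Measure ℝ) [IsProbabilityMeasure μ] [NullSingletonClass μ] :
    ∀ᵐ x ∂(Measure.pi fun _ : Fin n => μ), Function.Injective x := by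
  have h : ∀ i j : Fin n, i ≠ j → ∀ᵐ x ∂(Measure.pi fun _ : Fin n => μ), x i ≠ x j := by
    intro i j hij
    have hind : iIndepFun (fun (i : Fin n) (x : Fin n → ℝ) => x i)
        (Measure.pi fun _ : Fin n => μ) :=
      iIndepFun_pi (X := fun _ => id) (fun _ => by fun_prop)
    have h2 := (indepFun_iff_map_prod_eq_prod_map_map (measurable_pi_apply i).aemeasurable
      (measurable_pi_apply j).aemeasurable).1
      (hind.indepFun hij)
    have e1 : ∀ i, (Measure.pi fun _ : Fin n => μ).map (fun x => x i) = μ := fun i =>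
      (measurePreserving_eval (fun _ : Fin n => μ) i).map_eq
    rw [e1, e1] at h2
    have h3 : ∀ᵐ p ∂(μ.prod μ), p.1 ≠ p.2 := by
      rw [ae_iff]
      simp only [ne_eq, not_not]
      have hm : MeasurableSet {p : ℝ × ℝ | p.1 = p.2} :=
        measurableSet_eq_fun measurable_fst measurable_snd
      rw [Measure.prod_apply hm]
      simp
    rw [← h2] at h3
    exact ae_of_ae_map
      ((measurable_pi_apply i).prodMk (measurable_pi_apply j)).aemeasurable h3
  have h' : ∀ᵐ x ∂(Measure.pi fun _ : Fin n => μ), ∀ i j, i ≠ j → x i ≠ x j := by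
    rw [ae_all_iff]; intro i
    rw [ae_all_iff]; intro j
    by_cases hij : i = j
    · simp [hij]
    · filter_upwards [h i j hij] with x hx _ using hx
  filter_upwards [h'] with x hx i j hij
  by_contra hne
  exact hx i j hne hij

open Classical in
/-- The number of rearrangements of a sample without ties which fall into the pivot set does not
depend on the sample. -/
theorem exists_card_perm_mem_pivotSet (e : Unit ⊕ (Fin m ⊕ Fin r) ≃ Fin n) :
    ∃ c : ℕ, c ≠ 0 ∧ ∀ x : Fin n → ℝ, Function.Injective x → (∀ i, 0 < x i) →
      (Finset.univ.filter fun σ : Equiv.Perm (Fin n) => x ∘ σ ∈ pivotSet e).card = c := by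
  have key : ∀ x : Fin n → ℝ, Function.Injective x → (∀ i, 0 < x i) →
      (Finset.univ.filter fun σ : Equiv.Perm (Fin n) => x ∘ σ ∈ pivotSet e).card =
      (Finset.univ.filter fun σ : Equiv.Perm (Fin n) =>
        (∀ j, σ (e (.inl ())) < σ (e (.inr (.inl j)))) ∧
          ∀ l, σ (e (.inr (.inr l))) < σ (e (.inl ()))).card := by
    intro x hx hpos
    set s := Tuple.sort x
    have hy : StrictMono (x ∘ s) :=
      (Tuple.monotone_sort x).strictMono_of_injective (hx.comp s.injective)
    refine Finset.card_equiv (Equiv.mulLeft s⁻¹) fun σ => ?_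
    have hlt : ∀ a b : Fin n, x a < x b ↔ s⁻¹ a < s⁻¹ b := by
      intro a b
      rw [← hy.lt_iff_lt]
      simp
    simp only [pivotSet, Function.comp_apply, Finset.mem_filter, Finset.mem_univ, true_and,
      Set.mem_ofPred_eq, Equiv.coe_mulLeft, Equiv.Perm.mul_apply, hlt]
    simp [hpos]
  refine ⟨_, ?_, key⟩
  -- `c` is not zero: for a sample in the pivot set, the identity is counted
  let w : Unit ⊕ (Fin m ⊕ Fin r) → ℕ :=
    Sum.elim (fun _ => r + 1) (Sum.elim (fun j => r + 2 + j) (fun l => l + 1))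
  have hw : Function.Injective w := by
    rintro (a | a | a) (b | b | b) h <;> simp [w] at h ⊢ <;> try omega
  let x : Fin n → ℝ := fun i => (w (e.symm i) : ℝ)
  have hx : Function.Injective x := fun i j h => e.symm.injective (hw (Nat.cast_injective h))
  have hxpos : ∀ i, 0 < x i := by
    intro i
    simp only [x, Nat.cast_pos]
    rcases e.symm i with a | a | a <;> simp [w]
  rw [← key x hx hxpos]
  refine Finset.card_ne_zero.2 ⟨1, ?_⟩
  simp only [Finset.mem_filter, Finset.mem_univ, true_and]
  refine ⟨fun i => hxpos _, fun j => ?_, fun l => ?_⟩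
  · simp only [Function.comp, x, Equiv.Perm.one_apply, Equiv.symm_apply_apply, Nat.cast_lt]
    simp [w]; omega
  · simp only [Function.comp, x, Equiv.Perm.one_apply, Equiv.symm_apply_apply, Nat.cast_lt]
    simp [w]

/-- The integral of a symmetric function is a multiple of its integral over the pivot set. -/
theorem lintegral_symmetric (μ : Measure ℝ) [IsProbabilityMeasure μ] [NullSingletonClass μ]
    (hμ : ∀ᵐ x ∂μ, 0 < x) (e : Unit ⊕ (Fin m ⊕ Fin r) ≃ Fin n) :
    ∃ C : ENNReal, ∀ g : (Fin n → ℝ) → ENNReal, Measurable g →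
      (∀ (σ : Equiv.Perm (Fin n)) x, g (x ∘ σ) = g x) →
      ∫⁻ x, g x ∂(Measure.pi fun _ => μ) =
        C * ∫⁻ x in pivotSet e, g x ∂(Measure.pi fun _ => μ) := by
  classical
  obtain ⟨c, hc, hcard⟩ := exists_card_perm_mem_pivotSet e
  refine ⟨(c : ENNReal)⁻¹ * (Fintype.card (Equiv.Perm (Fin n)) : ENNReal), fun g hg hsymm => ?_⟩
  set ν : Measure (Fin n → ℝ) := Measure.pi fun _ => μ
  have hS := measurableSet_pivotSet e
  have hpos : ∀ᵐ x ∂ν, ∀ i, 0 < x i := by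
    rw [ae_all_iff]
    intro i
    exact (measurePreserving_eval (fun _ : Fin n => μ) i).quasiMeasurePreserving.ae hμ
  have hmp : ∀ σ : Equiv.Perm (Fin n), MeasurePreserving (fun x : Fin n → ℝ => x ∘ σ) ν ν := by
    intro σ
    refine ⟨by fun_prop, (Measure.pi_eq fun s hs => ?_).symm⟩
    rw [Measure.map_apply (by fun_prop) (.univ_pi hs)]
    have : (fun x : Fin n → ℝ => x ∘ σ) ⁻¹' Set.univ.pi s
        = Set.univ.pi fun i => s (σ.symm i) := by
      ext x
      simp only [Set.mem_preimage, Set.mem_pi, Set.mem_univ, true_imp_iff, Function.comp]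
      rw [← σ.forall_congr_right (q := fun i => x i ∈ s (σ.symm i))]
      simp
    rw [this, Measure.pi_pi]
    exact Equiv.prod_comp σ.symm (fun i => μ (s i))
  have h1 : (c : ENNReal) * ∫⁻ x, g x ∂ν =
      ∑ σ : Equiv.Perm (Fin n), ∫⁻ x, (pivotSet e).indicator g (x ∘ σ) ∂ν := by
    rw [← lintegral_const_mul _ hg, ← lintegral_finsetSum]
    · refine lintegral_congr_ae ?_
      filter_upwards [ae_injective_pi μ, hpos] with x hx hx0
      rw [← hcard x hx hx0, Finset.card_filter]
      push_cast
      rw [Finset.sum_mul]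
      refine Finset.sum_congr rfl fun σ _ => ?_
      by_cases h : x ∘ σ ∈ pivotSet e <;> simp [h, hsymm]
    · intro σ _
      exact (hg.indicator hS).comp (hmp σ).measurable
  have h2 : ∀ σ : Equiv.Perm (Fin n), ∫⁻ x, (pivotSet e).indicator g (x ∘ σ) ∂ν =
      ∫⁻ x in pivotSet e, g x ∂ν := by
    intro σ
    rw [(hmp σ).lintegral_comp (hg.indicator hS), lintegral_indicator hS]
  simp only [h2, Finset.sum_const, Finset.card_univ, nsmul_eq_mul] at h1
  rw [mul_assoc, ← h1, ← mul_assoc, ENNReal.inv_mul_cancel (by exact_mod_cast hc) (by simp),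
    one_mul]

/-- Conditionally on exceeding `t`, the excesses of an exponential sample over `t` form again an
exponential sample. -/
theorem lintegral_pi_shift {t : ℝ} (ht : 0 ≤ t) {f : (Fin m → ℝ) → ENNReal} (hf : Measurable f) :
    ∫⁻ y in Set.univ.pi fun _ => Set.Ioi t, f (fun j => y j - t)
        ∂(Measure.pi fun _ : Fin m => expMeasure 1) =
      ENNReal.ofReal (Real.exp (-t)) ^ m *
        ∫⁻ y, f y ∂(Measure.pi fun _ : Fin m => expMeasure 1) := by
  have h : ((Measure.pi fun _ : Fin m => expMeasure 1).restrict
      (Set.univ.pi fun _ => Set.Ioi t)).map (fun y j => y j - t) =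
      ENNReal.ofReal (Real.exp (-t)) ^ m • Measure.pi fun _ : Fin m => expMeasure 1 := by
    rw [Measure.restrict_pi_pi]
    have h1 := Measure.pi_map_pi (μ := fun _ : Fin m => (expMeasure 1).restrict (Set.Ioi t))
      (f := fun _ x => x - t) (fun _ => by fun_prop)
    rw [h1, map_sub_restrict_expMeasure ht]
    have hfin : IsFiniteMeasure (ENNReal.ofReal (Real.exp (-t)) • expMeasure 1) :=
      Measure.smul_finite _ ENNReal.ofReal_ne_top
    refine Measure.pi_eq fun s hs => ?_
    simp [Measure.pi_pi, Finset.prod_mul_distrib]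
  rw [← lintegral_map hf (by fun_prop), h, lintegral_smul_measure, smul_eq_mul]

/-- A weak form of Rényi's representation. For an exponential sample of size `n = m + 1 + r`, the
`(m + 1)`-th largest value and the excesses over it of the `m` larger ones are distributed, as far
as symmetric functions are concerned, as a variable `T` and an independent exponential sample of
size `m`. -/
theorem exists_law_pivot (e : Unit ⊕ (Fin m ⊕ Fin r) ≃ Fin n) :
    ∃ τ : Measure ℝ, IsProbabilityMeasure τ ∧
      ∀ (g : (Fin n → ℝ) → ENNReal) (ψ : ℝ × (Fin m → ℝ) → ENNReal),
        Measurable g → Measurable ψ → (∀ (σ : Equiv.Perm (Fin n)) x, g (x ∘ σ) = g x) →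
        (∀ p, glue e p ∈ pivotSet e → g (glue e p) = ψ (p.1, fun j => p.2.1 j - p.1)) →
        ∫⁻ x, g x ∂(Measure.pi fun _ => expMeasure 1) =
          ∫⁻ q, ψ q ∂(τ.prod (Measure.pi fun _ => expMeasure 1)) := by
  obtain ⟨C, hC⟩ := lintegral_symmetric (expMeasure 1) ae_pos_expMeasure e
  set μ := expMeasure 1
  set w : ℝ → ENNReal := fun t => C * (μ (Set.Ioo 0 t) ^ r * ENNReal.ofReal (Real.exp (-t)) ^ m)
  have hw : Measurable w := by
    have : Measurable fun t => μ (Set.Ioo 0 t) := by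
      refine Monotone.measurable fun a b hab => measure_mono (Set.Ioo_subset_Ioo_right hab)
    exact .const_mul ((this.pow_const r).mul (by fun_prop)) C
  -- the pivot has density `w` with respect to the exponential law: `r` values fall below it, and
  -- the `m` values above it contribute the factor `exp (-t) ^ m` by the lack of memory
  have main : ∀ (g : (Fin n → ℝ) → ENNReal) (ψ : ℝ × (Fin m → ℝ) → ENNReal),
        Measurable g → Measurable ψ → (∀ (σ : Equiv.Perm (Fin n)) x, g (x ∘ σ) = g x) →
        (∀ p, glue e p ∈ pivotSet e → g (glue e p) = ψ (p.1, fun j => p.2.1 j - p.1)) →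
        ∫⁻ x, g x ∂(Measure.pi fun _ => μ) =
          ∫⁻ q, ψ q ∂((μ.withDensity w).prod (Measure.pi fun _ => μ)) := by
    intro g ψ hg hψ hsymm hgψ
    have hS := measurableSet_pivotSet e
    have hmeas : Measurable fun p => (pivotSet e).indicator g (glue e p) :=
      (hg.indicator hS).comp (measurable_glue e)
    rw [hC g hg hsymm, ← lintegral_indicator hS,
      ← (measurePreserving_glue μ e).lintegral_comp (hg.indicator hS),
      lintegral_prod _ hmeas.aemeasurable,
      lintegral_prod _ hψ.aemeasurable, lintegral_withDensity_eq_lintegral_mul _ hw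
        hψ.lintegral_prod_right', ← lintegral_const_mul _ hmeas.lintegral_prod_right']
    refine lintegral_congr_ae ?_
    filter_upwards [ae_pos_expMeasure] with t ht
    have hset : ∀ y z, glue e (t, y, z) ∈ pivotSet e ↔
        y ∈ (Set.univ.pi fun _ => Set.Ioi t) ∧ z ∈ (Set.univ.pi fun _ => Set.Ioo 0 t) := by
      intro y z
      simp only [pivotSet, Set.mem_ofPred_eq, Set.mem_pi, Set.mem_univ, true_imp_iff]
      rw [← e.forall_congr_right]
      simp only [glue, Equiv.symm_apply_apply, Sum.forall, Sum.elim_inl, Sum.elim_inr,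
        Set.mem_Ioi, Set.mem_Ioo]
      constructor
      · rintro ⟨⟨h1, h2, h3⟩, h4, h5⟩
        exact ⟨h4, fun l => ⟨h3 l, h5 l⟩⟩
      · rintro ⟨h1, h2⟩
        exact ⟨⟨fun _ => ht, fun j => ht.trans (h1 j), fun l => (h2 l).1⟩, h1, fun l => (h2 l).2⟩
    have hval : ∀ y z, (pivotSet e).indicator g (glue e (t, y, z)) =
        (Set.univ.pi fun _ => Set.Ioi t).indicator
            (fun y : Fin m → ℝ => ψ (t, fun j => y j - t)) y *
          (Set.univ.pi fun _ => Set.Ioo 0 t).indicator (fun _ => 1) z := by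
      intro y z
      by_cases hy : y ∈ (Set.univ.pi fun _ => Set.Ioi t) <;>
      by_cases hz : z ∈ (Set.univ.pi fun _ => Set.Ioo 0 t)
      · have hmem := (hset y z).2 ⟨hy, hz⟩
        rw [Set.indicator_of_mem hmem, Set.indicator_of_mem hy, Set.indicator_of_mem hz,
          hgψ _ hmem, mul_one]
      all_goals
        rw [Set.indicator_of_notMem (fun h => by have := (hset y z).1 h; tauto)]
        simp [hy, hz]
    have hmi : MeasurableSet (Set.univ.pi fun _ : Fin m => Set.Ioi t) :=
      .univ_pi fun _ => measurableSet_Ioi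
    have hmo : MeasurableSet (Set.univ.pi fun _ : Fin r => Set.Ioo 0 t) :=
      .univ_pi fun _ => measurableSet_Ioo
    have hψt : Measurable fun y : Fin m → ℝ => ψ (t, y) := hψ.comp (by fun_prop)
    have hψs : Measurable fun y : Fin m → ℝ => ψ (t, fun j => y j - t) := hψ.comp (by fun_prop)
    simp only [Pi.mul_apply, hval]
    rw [lintegral_prod_mul (hψs.indicator hmi).aemeasurable
      (measurable_const.indicator hmo).aemeasurable, lintegral_indicator hmi,
      lintegral_pi_shift ht.le hψt, lintegral_indicator hmo]
    simp only [lintegral_const, Measure.restrict_apply, MeasurableSet.univ, Set.univ_inter,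
      Measure.pi_pi, Finset.prod_const, Finset.card_univ, Fintype.card_fin, one_mul, w]
    ring
  refine ⟨μ.withDensity w, ⟨?_⟩, main⟩
  have h1 := main (fun _ => 1) (fun _ => 1) (by fun_prop) (by fun_prop) (by simp) (by simp)
  simp only [lintegral_const, one_mul] at h1
  rw [measure_univ (μ := Measure.pi fun _ : Fin n => μ), ← Set.univ_prod_univ, Measure.prod_prod,
    measure_univ (μ := Measure.pi fun _ : Fin m => μ), mul_one] at h1
  exact h1.symm

end

/-! ### The quantile coupling -/

theorem coe_le_failureRate_iff (F : ℝ → ℝ) (t x : ℝ) :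
    (t : EReal) ≤ failureRate F x ↔ 1 - Real.exp (-t) ≤ F x := by
  unfold failureRate
  rw [ENNReal.log_ofReal]
  split_ifs with h
  · simp only [EReal.neg_bot, le_top, true_iff]
    have := Real.exp_pos (-t)
    linarith
  · push Not at h
    rw [← EReal.coe_neg, EReal.coe_le_coe_iff, le_neg, Real.log_le_iff_le_exp h]
    constructor <;> intro h <;> linarith

section

variable {κ : Measure ℝ} {F : ℝ → ℝ}

/-- For `t ≤ 0` the defining set is the whole line, whose infimum is `0` by convention. -/
theorem invFailureRate_of_nonpos (hF : ∀ x, κ.real (Set.Iic x) = F x) {t : ℝ} (ht : t ≤ 0) :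
    invFailureRate F t = 0 := by
  unfold invFailureRate
  have : {x : ℝ | (t : EReal) ≤ failureRate F x} = Set.univ := by
    ext x
    simp only [Set.mem_ofPred_eq, coe_le_failureRate_iff, Set.mem_univ, iff_true]
    have h1 : 1 ≤ Real.exp (-t) := Real.one_le_exp (by linarith)
    have h2 : 0 ≤ F x := by rw [← hF]; positivity
    linarith
  rw [this, Real.sInf_univ]

variable [IsProbabilityMeasure κ]

/-- The Galois connection between the generalized inverse and `F`; the infimum defining the inverse
is attained since `F` is right continuous. -/
theorem invFailureRate_le_iff (hF : ∀ x, κ.real (Set.Iic x) = F x) {t : ℝ} (ht : 0 < t) (x : ℝ) :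
    invFailureRate F t ≤ x ↔ 1 - Real.exp (-t) ≤ F x := by
  have hcdf : ∀ x, F x = cdf κ x := fun x => by rw [cdf_eq_real, hF]
  set c := 1 - Real.exp (-t)
  have hc0 : 0 < c := by
    have : Real.exp (-t) < 1 := Real.exp_lt_one_iff.2 (by linarith)
    simp only [c]; linarith
  have hc1 : c < 1 := by
    have := Real.exp_pos (-t)
    simp only [c]; linarith
  have hset : {x : ℝ | (t : EReal) ≤ failureRate F x} = {x | c ≤ cdf κ x} := by
    ext y
    simp only [Set.mem_ofPred_eq, coe_le_failureRate_iff, hcdf, c]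
  have hne : {x | c ≤ cdf κ x}.Nonempty := by
    obtain ⟨y, hy⟩ := ((tendsto_cdf_atTop κ).eventually (eventually_ge_nhds hc1)).exists
    exact ⟨y, hy⟩
  have hbdd : BddBelow {x | c ≤ cdf κ x} := by
    obtain ⟨y, hy⟩ := ((tendsto_cdf_atBot κ).eventually (eventually_lt_nhds hc0)).exists
    refine ⟨y, fun z hz => ?_⟩
    by_contra hzy
    push Not at hzy
    have h1 : c ≤ cdf κ z := hz
    have := monotone_cdf κ hzy.le
    linarith
  unfold invFailureRate
  rw [hset, hcdf]
  constructor
  · intro h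
    -- the infimum belongs to the set by right continuity
    have hcont : Tendsto (cdf κ) (𝓝[>] x) (𝓝 (cdf κ x)) :=
      ((cdf κ).right_continuous x).mono Set.Ioi_subset_Ici_self
    refine ge_of_tendsto hcont ?_
    filter_upwards [self_mem_nhdsWithin] with y hy
    obtain ⟨z, hz, hzy⟩ := (csInf_lt_iff hbdd hne).1 (lt_of_le_of_lt h hy)
    exact le_trans hz (monotone_cdf κ hzy.le)
  · intro h
    exact csInf_le hbdd h

theorem monotoneOn_invFailureRate (hF : ∀ x, κ.real (Set.Iic x) = F x) :
    MonotoneOn (invFailureRate F) (Set.Ioi 0) := by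
  intro s hs t ht hst
  rw [invFailureRate_le_iff hF hs]
  have h := (invFailureRate_le_iff hF ht _).1 le_rfl
  have : Real.exp (-t) ≤ Real.exp (-s) := Real.exp_le_exp.2 (by linarith)
  linarith

theorem measurable_invFailureRate (hF : ∀ x, κ.real (Set.Iic x) = F x) :
    Measurable (invFailureRate F) := by
  refine measurable_of_Iic fun x => ?_
  have : invFailureRate F ⁻¹' Set.Iic x =
      (Set.Ioi 0 ∩ {t | 1 - Real.exp (-t) ≤ F x}) ∪ (Set.Iic 0 ∩ {_t | 0 ≤ x}) := by
    ext t
    rcases le_or_gt t 0 with ht | ht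
    · simp [invFailureRate_of_nonpos hF ht, ht]
    · simp [invFailureRate_le_iff hF ht, ht]
  rw [this]
  exact (measurableSet_Ioi.inter (measurableSet_le (by fun_prop) measurable_const)).union
    (measurableSet_Iic.inter (.const _))

theorem expMeasure_setOf_one_sub_exp_le {p : ℝ} (h0 : 0 ≤ p) (h1 : p ≤ 1) :
    expMeasure 1 {t | 1 - Real.exp (-t) ≤ p} = ENNReal.ofReal p := by
  rcases h1.eq_or_lt with rfl | h1
  · have : {t : ℝ | 1 - Real.exp (-t) ≤ 1} = Set.univ := by
      ext t; simp [(Real.exp_pos _).le]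
    rw [this, measure_univ, ENNReal.ofReal_one]
  · have h2 : 0 < 1 - p := by linarith
    have : {t : ℝ | 1 - Real.exp (-t) ≤ p} = Set.Iic (-Real.log (1 - p)) := by
      ext t
      simp only [Set.mem_ofPred_eq, Set.mem_Iic]
      rw [le_neg, Real.log_le_iff_le_exp h2]
      constructor <;> intro h <;> linarith
    rw [this, expMeasure_Iic, neg_neg, Real.exp_log h2]
    · ring_nf
    · have := Real.log_nonpos h2.le (by linarith)
      linarith

/-- If `E` is standard exponential, then `H^←(E)` has distribution function `F`. -/
theorem map_invFailureRate_expMeasure (hF : ∀ x, κ.real (Set.Iic x) = F x) :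
    (expMeasure 1).map (invFailureRate F) = κ := by
  have hm := measurable_invFailureRate hF
  have : IsProbabilityMeasure ((expMeasure 1).map (invFailureRate F)) :=
    Measure.isProbabilityMeasure_map hm.aemeasurable
  refine Measure.ext_of_Iic _ _ fun x => ?_
  rw [Measure.map_apply hm measurableSet_Iic]
  have : (invFailureRate F ⁻¹' Set.Iic x : Set ℝ) =ᵐ[expMeasure 1]
      {t | 1 - Real.exp (-t) ≤ F x} := by
    filter_upwards [ae_pos_expMeasure] with t ht
    exact propext (invFailureRate_le_iff hF ht x)
  rw [measure_congr this, expMeasure_setOf_one_sub_exp_le, ← hF, ofReal_measureReal]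
  · rw [← hF]; positivity
  · rw [← hF]; exact measureReal_le_one

/-! ### Regular variation of the tail -/

/-- The first order condition forces `H^←` to be positive near infinity: the ratio
`H^←(2t) / H^←(t)` tends to `2 ^ θ > 1`, which a monotone function can only achieve with positive
values. -/
theorem FirstOrder.eventually_pos (hF : ∀ x, κ.real (Set.Iic x) = F x) {θ : ℝ} (hθ : 0 < θ)
    {ℓ : ℝ → ℝ} (h : FirstOrder F θ ℓ) :
    ∃ T, 0 < T ∧ ∀ t, T ≤ t → 0 < invFailureRate F t := by
  have h2 : 1 < (2:ℝ) ^ θ := Real.one_lt_rpow (by norm_num) hθ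
  have h3 : ((2:ℝ) ^ θ)⁻¹ < 1 := inv_lt_one_of_one_lt₀ h2
  obtain ⟨T, hT⟩ := eventually_atTop.1
    ((h.slow 2 two_pos).eventually (eventually_gt_nhds h3))
  refine ⟨max T 1, by positivity, fun t ht => ?_⟩
  have ht0 : 0 < t := lt_of_lt_of_le one_pos ((le_max_right _ _).trans ht)
  have hr := hT t ((le_max_left _ _).trans ht)
  have hmono : invFailureRate F t ≤ invFailureRate F (2 * t) :=
    monotoneOn_invFailureRate hF ht0 (by simpa using ht0) (by linarith)
  rw [h.eq t ht0]
  rw [h.eq t ht0, h.eq (2 * t) (by linarith), Real.mul_rpow two_pos.le ht0.le] at hmono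
  have htθ : 0 < t ^ θ := Real.rpow_pos_of_pos ht0 θ
  have hmono' : ℓ t ≤ 2 ^ θ * ℓ (2 * t) := by
    refine le_of_mul_le_mul_left ?_ htθ
    linarith
  refine mul_pos htθ ?_
  by_contra hneg
  push Not at hneg
  have hpos : 0 < ((2:ℝ) ^ θ)⁻¹ := by positivity
  rcases hneg.eq_or_lt with h0 | h0
  · rw [h0, div_zero] at hr
    linarith
  · rw [lt_div_iff_of_neg h0] at hr
    have : 2 ^ θ * ℓ (2 * t) < 2 ^ θ * (((2:ℝ) ^ θ)⁻¹ * ℓ t) := by gcongr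
    rw [← mul_assoc, mul_inv_cancel₀ (by positivity), one_mul] at this
    linarith

theorem intervalIntegrable_rpow_sub_one (ρ : ℝ) {a b : ℝ} (ha : 1 ≤ a) (hb : 1 ≤ b) :
    IntervalIntegrable (fun u : ℝ => u ^ (ρ - 1)) volume a b := by
  refine intervalIntegral.intervalIntegrable_rpow (Or.inr ?_)
  intro h
  have := Set.mem_uIcc.1 h
  rcases this with ⟨h1, h2⟩ | ⟨h1, h2⟩ <;> linarith

theorem kernelK_nonneg (ρ : ℝ) {s : ℝ} (hs : 1 ≤ s) : 0 ≤ kernelK ρ s := by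
  refine intervalIntegral.integral_nonneg hs fun u hu => ?_
  have : 0 ≤ u := by linarith [hu.1]
  positivity

theorem kernelK_le {ρ : ℝ} (hρ : ρ ≤ 0) {s : ℝ} (hs : 1 ≤ s) : kernelK ρ s ≤ s - 1 := by
  have h : kernelK ρ s ≤ ∫ _u in (1:ℝ)..s, (1:ℝ) :=
    intervalIntegral.integral_mono_on hs (intervalIntegrable_rpow_sub_one ρ le_rfl hs)
      intervalIntegrable_const fun u hu =>
        Real.rpow_le_one_of_one_le_of_nonpos hu.1 (by linarith)
  simpa using h

theorem le_kernelK_sub {ρ : ℝ} (hρ : ρ ≤ 0) {s : ℝ} (hs : 1 ≤ s) (hs2 : s ≤ 2) :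
    (4:ℝ) ^ (ρ - 1) ≤ kernelK ρ (2 * s) - kernelK ρ s := by
  unfold kernelK
  rw [intervalIntegral.integral_interval_sub_left
    (intervalIntegrable_rpow_sub_one ρ le_rfl (by linarith))
    (intervalIntegrable_rpow_sub_one ρ le_rfl hs)]
  have h : ∫ _u in s..2 * s, (4:ℝ) ^ (ρ - 1) ≤ ∫ u in s..2 * s, u ^ (ρ - 1) :=
    intervalIntegral.integral_mono_on (by linarith) intervalIntegrable_const
      (intervalIntegrable_rpow_sub_one ρ hs (by linarith)) fun u hu =>
        Real.rpow_le_rpow_of_nonpos (by linarith [hu.1]) (by linarith [hu.2]) (by linarith)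
  rw [intervalIntegral.integral_const, smul_eq_mul] at h
  have : (0:ℝ) ≤ 4 ^ (ρ - 1) := by positivity
  nlinarith

variable {θ ρ : ℝ} {ℓ b : ℝ → ℝ}

/-- The increments of `log H^←` agree with those of `θ log`, up to an error of order `b`. -/
theorem FirstOrder.exists_abs_log_sub_le (hF : ∀ x, κ.real (Set.Iic x) = F x) (hθ : 0 < θ)
    (h1 : FirstOrder F θ ℓ) (h2 : SecondOrder ℓ b ρ) :
    ∃ T, ∀ t, T ≤ t → ∀ s, 1 < s → s ≤ 2 →
      |Real.log (invFailureRate F (s * t)) - Real.log (invFailureRate F t) - θ * Real.log s| ≤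
        2 * |b t| * (s - 1) := by
  obtain ⟨T₀, hT₀, hpos⟩ := h1.eventually_pos hF hθ
  obtain ⟨T₁, hT₁⟩ := h2.equiv 2 one_lt_two 1 one_pos
  refine ⟨max T₀ T₁, fun t ht s hs hs2 => ?_⟩
  have htT := (le_max_left _ _).trans ht
  have ht0 : 0 < t := hT₀.trans_le htT
  have hst : T₀ ≤ s * t := by nlinarith
  have hst0 : 0 < s * t := hT₀.trans_le hst
  have hY1 := hpos t htT
  have hY2 := hpos _ hst
  rw [h1.eq t ht0] at hY1
  rw [h1.eq _ hst0] at hY2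
  have hℓ1 : 0 < ℓ t := pos_of_mul_pos_right hY1 (by positivity)
  have hℓ2 : 0 < ℓ (s * t) := pos_of_mul_pos_right hY2 (by positivity)
  have hlog : Real.log (invFailureRate F (s * t)) - Real.log (invFailureRate F t)
      - θ * Real.log s = Real.log (ℓ (s * t) / ℓ t) := by
    rw [h1.eq t ht0, h1.eq _ hst0, Real.log_mul (by positivity) hℓ2.ne',
      Real.log_mul (by positivity) hℓ1.ne', Real.log_rpow hst0, Real.log_rpow ht0,
      Real.log_mul (by positivity) ht0.ne', Real.log_div hℓ2.ne' hℓ1.ne']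
    ring
  rw [hlog]
  have h := hT₁ t ((le_max_right _ _).trans ht) s hs hs2
  have hK0 := kernelK_nonneg ρ hs.le
  have hK1 := kernelK_le h2.nonpos hs.le
  have h3 := abs_sub_abs_le_abs_sub (Real.log (ℓ (s * t) / ℓ t)) (b t * kernelK ρ s)
  have h4 : |b t * kernelK ρ s| ≤ |b t| * (s - 1) := by
    rw [abs_mul, abs_of_nonneg hK0]
    gcongr
  linarith

/-- The auxiliary function `b` inherits regular variation from the second order condition: the
increments of `log ℓ` are additive in the sense that
`log (ℓ(2st)/ℓ(t)) = log (ℓ(2st)/ℓ(st)) + log (ℓ(st)/ℓ(t))`, which ties `b (s t)` to `b t`. -/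
theorem SecondOrder.exists_abs_le_mul (hF : ∀ x, κ.real (Set.Iic x) = F x) (hθ : 0 < θ)
    (h1 : FirstOrder F θ ℓ) (h2 : SecondOrder ℓ b ρ) :
    ∃ C, 0 ≤ C ∧ ∃ T, ∀ t, T ≤ t → ∀ s, 1 ≤ s → s ≤ 2 → |b t| ≤ C * |b (s * t)| := by
  obtain ⟨T₀, hT₀, hpos⟩ := h1.eventually_pos hF hθ
  set c : ℝ := 4 ^ (ρ - 1)
  have hc : 0 < c := by positivity
  have hc1 : c ≤ 1 := Real.rpow_le_one_of_one_le_of_nonpos (by norm_num) (by linarith [h2.nonpos])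
  obtain ⟨T₁, hT₁⟩ := h2.equiv 4 (by norm_num) (c / 12) (by positivity)
  refine ⟨4 / c, by positivity, max T₀ T₁, fun t ht s hs hs2 => ?_⟩
  have htT := (le_max_left _ _).trans ht
  have htT1 := (le_max_right _ _).trans ht
  have ht0 : 0 < t := hT₀.trans_le htT
  have hℓ : ∀ u, T₀ ≤ u → 0 < ℓ u := fun u hu => by
    have hu0 : 0 < u := hT₀.trans_le hu
    have h := hpos u hu
    rw [h1.eq u hu0] at h
    exact pos_of_mul_pos_right h (by positivity)
  have hst : t ≤ s * t := by nlinarith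
  have hst2 : t ≤ 2 * s * t := by nlinarith
  have hℓ0 := hℓ t htT
  have hℓ1 := hℓ (s * t) (htT.trans hst)
  have hℓ2 := hℓ (2 * s * t) (htT.trans hst2)
  -- the approximation also holds for `s = 1`, where both sides vanish
  have ha : |Real.log (ℓ (s * t) / ℓ t) - b t * kernelK ρ s| ≤ c / 12 * |b t * kernelK ρ s| := by
    rcases hs.eq_or_lt with rfl | hs'
    · simp [kernelK, div_self hℓ0.ne']
    · exact hT₁ t htT1 s hs' (by linarith)
  have hb := hT₁ t htT1 (2 * s) (by linarith) (by linarith)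
  have hd := hT₁ (s * t) (htT1.trans hst) 2 (by norm_num) (by norm_num)
  rw [← mul_assoc 2 s t] at hd
  have hcocycle : Real.log (ℓ (2 * s * t) / ℓ t) =
      Real.log (ℓ (2 * s * t) / ℓ (s * t)) + Real.log (ℓ (s * t) / ℓ t) := by
    rw [Real.log_div hℓ2.ne' hℓ0.ne', Real.log_div hℓ2.ne' hℓ1.ne', Real.log_div hℓ1.ne' hℓ0.ne']
    ring
  have hK := le_kernelK_sub h2.nonpos hs hs2
  have hKs := kernelK_nonneg ρ hs
  have hKs' := kernelK_le h2.nonpos hs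
  have hK2s := kernelK_nonneg ρ (s := 2 * s) (by linarith)
  have hK2s' := kernelK_le h2.nonpos (s := 2 * s) (by linarith)
  have hK2 := kernelK_nonneg ρ (s := 2) (by norm_num)
  have hK2' := kernelK_le h2.nonpos (s := 2) (by norm_num)
  rw [abs_mul, abs_of_nonneg hKs] at ha
  rw [abs_mul, abs_of_nonneg hK2s] at hb
  rw [abs_mul, abs_of_nonneg hK2] at hd
  set A := Real.log (ℓ (s * t) / ℓ t)
  set B := Real.log (ℓ (2 * s * t) / ℓ t)
  set D := Real.log (ℓ (2 * s * t) / ℓ (s * t))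
  have hβ : 0 ≤ |b t| := abs_nonneg _
  have hβ' : 0 ≤ |b (s * t)| := abs_nonneg _
  have hDabs : |D| ≤ 2 * |b (s * t)| := by
    have h3 := abs_sub_abs_le_abs_sub D (b (s * t) * kernelK ρ 2)
    rw [abs_mul, abs_of_nonneg hK2] at h3
    have h4 : |b (s * t)| * kernelK ρ 2 ≤ |b (s * t)| := by nlinarith
    nlinarith
  have hmain : |b t| * (kernelK ρ (2 * s) - kernelK ρ s) ≤
      |D| + c / 12 * (|b t| * kernelK ρ (2 * s)) + c / 12 * (|b t| * kernelK ρ s) := by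
    rw [← abs_of_nonneg (hc.le.trans hK), ← abs_mul]
    have : b t * (kernelK ρ (2 * s) - kernelK ρ s) =
        D - (B - b t * kernelK ρ (2 * s)) + (A - b t * kernelK ρ s) := by
      rw [hcocycle]; ring
    rw [this]
    refine (abs_add_le _ _).trans ?_
    have := abs_sub D (B - b t * kernelK ρ (2 * s))
    linarith
  have h5 : |b t| * c ≤ |b t| * (kernelK ρ (2 * s) - kernelK ρ s) := by gcongr
  have h6 : c / 12 * (|b t| * kernelK ρ (2 * s)) ≤ c / 12 * (|b t| * 3) := by
    gcongr; linarith
  have h7 : c / 12 * (|b t| * kernelK ρ s) ≤ c / 12 * (|b t| * 1) := by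
    gcongr; linarith
  rw [div_mul_eq_mul_div, le_div_iff₀ hc]
  nlinarith

end

/-! ### Order statistics -/

section

variable {m r n : ℕ}

/-- The increasing rearrangement of a finite sample. -/
noncomputable def sorted (v : Fin n → ℝ) : Fin n → ℝ := v ∘ Tuple.sort v

theorem monotone_sorted (v : Fin n → ℝ) : Monotone (sorted v) := Tuple.monotone_sort v

theorem sorted_comp_perm (v : Fin n → ℝ) (σ : Equiv.Perm (Fin n)) : sorted (v ∘ σ) = sorted v :=
  Tuple.comp_perm_comp_sort_eq_comp_sort

theorem card_filter_sorted (v : Fin n → ℝ) (p : ℝ → Prop) [DecidablePred p] :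
    (Finset.univ.filter fun i => p (sorted v i)).card =
      (Finset.univ.filter fun i => p (v i)).card :=
  Finset.card_equiv (Tuple.sort v) fun i => by
    simp only [Finset.mem_filter, Finset.mem_univ, true_and]; rfl

/-- Order statistics commute with monotone maps. -/
theorem sorted_comp_of_monotoneOn {Y : ℝ → ℝ} {S : Set ℝ} (hY : MonotoneOn Y S) {x : Fin n → ℝ}
    (hx : ∀ i, x i ∈ S) : sorted (Y ∘ x) = Y ∘ sorted x := by
  refine Tuple.unique_monotone (Tuple.monotone_sort (Y ∘ x)) (τ := Tuple.sort x) ?_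
  intro i j hij
  exact hY (hx _) (hx _) (Tuple.monotone_sort x hij)

theorem measurable_sorted (p : Fin n) : Measurable fun v : Fin n → ℝ => sorted v p := by
  refine measurable_of_Iic fun a => ?_
  have : (fun v : Fin n → ℝ => sorted v p) ⁻¹' Set.Iic a =
      {v | (p : ℕ) < ∑ i, if v i ≤ a then 1 else 0} := by
    ext v
    rw [Set.mem_preimage, Set.mem_Iic, Set.mem_ofPred_eq,
      ← Tuple.lt_card_le_iff_apply_le_of_monotone (monotone_sorted v),
      card_filter_sorted v (· ≤ a), Finset.card_filter]
  rw [this]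
  refine measurableSet_lt measurable_const (Finset.measurable_sum _ fun i _ => ?_)
  exact Measurable.ite (measurableSet_le (by fun_prop) measurable_const) measurable_const
    measurable_const

/-- The sum of the log-excesses over the `(r + 1)`-th smallest value of the sample. -/
noncomputable def logExcess (r : Fin n) (v : Fin n → ℝ) : ℝ :=
  ∑ p ∈ Finset.Ioi r, (Real.log (sorted v p) - Real.log (sorted v r))

theorem logExcess_comp_perm (r : Fin n) (v : Fin n → ℝ) (σ : Equiv.Perm (Fin n)) :
    logExcess r (v ∘ σ) = logExcess r v := by
  simp only [logExcess, sorted_comp_perm]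

theorem measurable_logExcess (r : Fin n) : Measurable (logExcess r) :=
  Finset.measurable_sum _ fun p _ =>
    (Real.measurable_log.comp (measurable_sorted p)).sub
      (Real.measurable_log.comp (measurable_sorted r))

theorem hillEstimator_eq (x : ℕ → ℝ) (hr : r < n) (hn : n = m + 1 + r) :
    hillEstimator x n (m + 1) = logExcess ⟨r, hr⟩ (fun i : Fin n => x i) /
      ∑ i ∈ Finset.Icc 1 m, (log₂ ((n : ℝ) / i) - log₂ ((n : ℝ) / (m + 1 : ℕ))) := by
  unfold hillEstimator logExcess
  simp only [Nat.add_sub_cancel]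
  congr 1
  have hos : ∀ j, ∀ hj : 1 ≤ j ∧ j ≤ n,
      orderStat x n j = sorted (fun i : Fin n => x i) ⟨j - 1, by omega⟩ := by
    intro j hj
    rw [orderStat, dif_pos hj]
    rfl
  symm
  refine Finset.sum_bij (fun p _ => n - p) ?_ ?_ ?_ ?_
  · intro p hp
    have := p.2
    simp only [Finset.mem_Ioi, Fin.lt_def] at hp
    simp only [Finset.mem_Icc]
    omega
  · intro p hp q hq h
    have := p.2
    have := q.2
    ext
    omega
  · intro i hi
    simp only [Finset.mem_Icc] at hi
    refine ⟨⟨n - i, by omega⟩, ?_, ?_⟩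
    · simp only [Finset.mem_Ioi, Fin.lt_def]; omega
    · simp only; omega
  · intro p hp
    have := p.2
    simp only [Finset.mem_Ioi, Fin.lt_def] at hp
    rw [hos (n - (n - p) + 1) (by omega), hos (n - (m + 1) + 1) (by omega)]
    congr 3
    · ext; simp only; omega
    · ext; simp only; omega

theorem sum_comp_pivot (e : Unit ⊕ (Fin m ⊕ Fin r) ≃ Fin n) {M : Type*} [AddCommMonoid M]
    (f : Fin n → M) :
    ∑ i, f i = f (e (.inl ())) + (∑ j, f (e (.inr (.inl j))) + ∑ l, f (e (.inr (.inr l)))) := by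
  rw [← e.sum_comp, Fintype.sum_sum_type, Fintype.sum_sum_type]
  simp

/-- On the pivot set the pivot is the `(r + 1)`-th smallest value, and the larger values are those
at the positions of the second kind. -/
theorem logExcess_of_mem_pivotSet (e : Unit ⊕ (Fin m ⊕ Fin r) ≃ Fin n) (hr : r < n)
    {Y : ℝ → ℝ} (hY : MonotoneOn Y (Set.Ioi 0)) {x : Fin n → ℝ} (hx : x ∈ pivotSet e) :
    logExcess ⟨r, hr⟩ (Y ∘ x) =
      ∑ j, (Real.log (Y (x (e (.inr (.inl j))))) - Real.log (Y (x (e (.inl ()))))) := by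
  obtain ⟨hpos, htop, hlow⟩ := hx
  set a := x (e (.inl ()))
  have hle : (Finset.univ.filter fun i => sorted x i ≤ a).card = r + 1 := by
    rw [card_filter_sorted x (· ≤ a), Finset.card_filter, sum_comp_pivot e]
    simp [a, htop, fun l => (hlow l).le, not_le.2, add_comm]
  have hlt : (Finset.univ.filter fun i => sorted x i < a).card = r := by
    rw [card_filter_sorted x (· < a), Finset.card_filter, sum_comp_pivot e]
    simp [a, fun j => (htop j).not_gt, hlow]
  have hpiv : sorted x ⟨r, hr⟩ = a := by
    refine le_antisymm ?_ ?_
    · rw [← Tuple.lt_card_le_iff_apply_le_of_monotone (monotone_sorted x), hle]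
      exact Nat.lt_succ_self r
    · rw [← not_lt, ← Tuple.lt_card_lt_iff_apply_lt_of_monotone (monotone_sorted x), hlt]
      exact lt_irrefl r
  have hIoi : Finset.Ioi (⟨r, hr⟩ : Fin n) = Finset.univ.filter fun p => a < sorted x p := by
    ext p
    simp only [Finset.mem_Ioi, Finset.mem_filter, Finset.mem_univ, true_and]
    rw [← not_le (b := a), ← Tuple.lt_card_le_iff_apply_le_of_monotone (monotone_sorted x), hle,
      Fin.lt_def, not_lt, Nat.succ_le_iff]
  unfold logExcess
  rw [sorted_comp_of_monotoneOn hY hpos, hIoi]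
  simp only [Function.comp_apply, hpiv]
  rw [Finset.sum_filter]
  have hperm : ∑ i, (if a < sorted x i then Real.log (Y (sorted x i)) - Real.log (Y a) else 0) =
      ∑ i, if a < x i then Real.log (Y (x i)) - Real.log (Y a) else 0 :=
    Equiv.sum_comp (Tuple.sort x)
      (fun i => if a < x i then Real.log (Y (x i)) - Real.log (Y a) else 0)
  rw [hperm, sum_comp_pivot e]
  simp [a, htop, fun l => (hlow l).not_gt]

/-- The number of sample values exceeding `t`. -/
noncomputable def exceedances (t : ℝ) (x : Fin n → ℝ) : ℝ := ∑ i, if t < x i then 1 else 0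

theorem measurable_exceedances (t : ℝ) : Measurable (exceedances (n := n) t) := by
  refine Finset.measurable_sum _ fun i _ => ?_
  exact Measurable.ite (measurableSet_lt measurable_const (by fun_prop)) measurable_const
    measurable_const

theorem exceedances_comp_perm (t : ℝ) (x : Fin n → ℝ) (σ : Equiv.Perm (Fin n)) :
    exceedances t (x ∘ σ) = exceedances t x :=
  Equiv.sum_comp σ (fun i => if t < x i then (1 : ℝ) else 0)

theorem le_exceedances_iff (e : Unit ⊕ (Fin m ⊕ Fin r) ≃ Fin n) {x : Fin n → ℝ}
    (hx : x ∈ pivotSet e) (t : ℝ) :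
    (m + 1 : ℝ) ≤ exceedances t x ↔ t < x (e (.inl ())) := by
  obtain ⟨-, htop, hlow⟩ := hx
  unfold exceedances
  rw [sum_comp_pivot e]
  constructor
  · intro h
    by_contra hle
    have h1 : ∑ j, (if t < x (e (.inr (.inl j))) then (1:ℝ) else 0) ≤ m := by
      refine (Finset.sum_le_card_nsmul _ _ 1 fun j _ => ?_).trans (by simp)
      split_ifs <;> norm_num
    have h2 : ∑ l, (if t < x (e (.inr (.inr l))) then (1:ℝ) else 0) = 0 :=
      Finset.sum_eq_zero fun l _ => if_neg fun h => hle (h.trans (hlow l))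
    rw [if_neg hle, h2] at h
    linarith
  · intro h
    have h1 : ∑ j, (if t < x (e (.inr (.inl j))) then (1:ℝ) else 0) = m := by
      simp [fun j => h.trans (htop j)]
    have h2 : 0 ≤ ∑ l, (if t < x (e (.inr (.inr l))) then (1:ℝ) else 0) :=
      Finset.sum_nonneg fun l _ => by split_ifs <;> norm_num
    rw [if_pos h, h1]
    linarith

/-! ### Concentration of the intermediate order statistic -/

/-- Chebyshev's inequality for the number of exceedances, a binomial variable. -/
theorem measure_exceedances_le {t δ : ℝ} (ht : 0 ≤ t) (hδ : 0 < δ) :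
    (Measure.pi fun _ : Fin n => expMeasure 1)
        {x | δ ≤ |exceedances t x - n * Real.exp (-t)|} ≤
      ENNReal.ofReal (n * Real.exp (-t) / δ ^ 2) := by
  set ν := Measure.pi fun _ : Fin n => expMeasure 1
  set h : ℝ → ℝ := fun u => if t < u then 1 else 0
  have hm : Measurable h := Measurable.ite (measurableSet_lt measurable_const measurable_id)
    measurable_const measurable_const
  have hbound : ∀ u, ‖h u‖ ≤ 1 := fun u => by
    simp only [h]; split_ifs <;> simp
  have hmean : ∫ u, h u ∂expMeasure 1 = Real.exp (-t) := by
    have : h = (Set.Ioi t).indicator 1 := by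
      ext u; simp [h, Set.indicator_apply]
    rw [this, integral_indicator_one measurableSet_Ioi, measureReal_def, expMeasure_Ioi ht,
      ENNReal.toReal_ofReal (Real.exp_pos _).le]
  have hmp : ∀ i, MeasurePreserving (fun x : Fin n → ℝ => x i) ν (expMeasure 1) := fun i =>
    measurePreserving_eval (fun _ : Fin n => expMeasure 1) i
  have hL2 : ∀ i, MemLp (fun x : Fin n → ℝ => h (x i)) 2 ν := fun i =>
    MemLp.of_bound (hm.comp (measurable_pi_apply i)).aestronglyMeasurable 1
      (.of_forall fun x => hbound _)
  have hmeani : ∀ i, ∫ x, h (x i) ∂ν = Real.exp (-t) := fun i => by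
    rw [← hmean, ← (hmp i).map_eq, integral_map (measurable_pi_apply i).aemeasurable
      hm.aestronglyMeasurable]
  have hvari : ∀ i, Var[fun x : Fin n → ℝ => h (x i); ν] ≤ Real.exp (-t) := fun i => by
    rw [variance_eq_sub (hL2 i)]
    have : ∀ u, h u ^ 2 = h u := fun u => by simp only [h]; split_ifs <;> simp
    simp only [Pi.pow_apply, this, hmeani]
    nlinarith [sq_nonneg (Real.exp (-t))]
  have hind : iIndepFun (fun (i : Fin n) (x : Fin n → ℝ) => h (x i)) ν :=
    iIndepFun_pi (X := fun _ => h) (fun _ => hm.aemeasurable)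
  have hex : (exceedances (n := n) t) = ∑ i, fun x : Fin n → ℝ => h (x i) := by
    ext x; simp [exceedances, h]
  have hmeanN : ∫ x, exceedances t x ∂ν = n * Real.exp (-t) := by
    unfold exceedances
    rw [integral_finsetSum _ fun i _ => (hL2 i).integrable (by norm_num)]
    change ∑ i : Fin n, ∫ x, h (x i) ∂ν = _
    simp [hmeani]
  have hvarN : Var[exceedances (n := n) t; ν] ≤ n * Real.exp (-t) := by
    rw [hex, IndepFun.variance_sum (fun i _ => hL2 i)
      (fun i _ j _ hij => hind.indepFun hij)]
    refine (Finset.sum_le_card_nsmul _ _ _ fun i _ => hvari i).trans ?_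
    simp
  have hL : MemLp (exceedances (n := n) t) 2 ν := by
    rw [hex]; exact memLp_finsetSum' _ fun i _ => hL2 i
  have := meas_ge_le_variance_div_sq hL hδ
  rw [hmeanN] at this
  refine this.trans (ENNReal.ofReal_le_ofReal ?_)
  gcongr

/-- The `(m + 1)`-th largest value of an exponential sample of size `n` is within distance `1` of
`log (n / (m + 1))`, with large probability. -/
theorem measure_pivot_le (e : Unit ⊕ (Fin m ⊕ Fin r) ≃ Fin n) {τ : Measure ℝ}
    [IsProbabilityMeasure τ]
    (hτ : ∀ (g : (Fin n → ℝ) → ENNReal) (ψ : ℝ × (Fin m → ℝ) → ENNReal),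
        Measurable g → Measurable ψ → (∀ (σ : Equiv.Perm (Fin n)) x, g (x ∘ σ) = g x) →
        (∀ p, glue e p ∈ pivotSet e → g (glue e p) = ψ (p.1, fun j => p.2.1 j - p.1)) →
        ∫⁻ x, g x ∂(Measure.pi fun _ => expMeasure 1) =
          ∫⁻ q, ψ q ∂(τ.prod (Measure.pi fun _ => expMeasure 1)))
    (hn : 1 ≤ Real.log ((n : ℝ) / (m + 1))) :
    τ {t | 1 < |t - Real.log ((n : ℝ) / (m + 1))|} ≤ ENNReal.ofReal (2 / (m + 1)) := by
  classical
  set k : ℝ := m + 1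
  have hk : 0 < k := by positivity
  set a := Real.log ((n : ℝ) / k)
  set ν := Measure.pi fun _ : Fin n => expMeasure 1
  have hn0 : 0 < (n : ℝ) / k := by
    by_contra h
    push Not at h
    have : (n : ℝ) / k = 0 := le_antisymm h (by positivity)
    simp only [a, this, Real.log_zero] at hn
    linarith
  -- `t` lies below the pivot exactly when at least `k` values exceed `t`
  have key : ∀ (t : ℝ) (p : Prop → Prop), τ {u | p (t < u)} = ν {x | p (k ≤ exceedances t x)} := by
    intro t p
    have hm1 : MeasurableSet {x : Fin n → ℝ | p (k ≤ exceedances t x)} :=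
      (measurable_from_top (f := p)).comp
        (measurableSet_setOfPred.1 (measurableSet_le measurable_const (measurable_exceedances t)))
        |>.setOf
    have hm2 : MeasurableSet {u : ℝ | p (t < u)} :=
      (measurable_from_top (f := p)).comp
        (measurableSet_setOfPred.1 (measurableSet_lt measurable_const measurable_id)) |>.setOf
    have h := hτ ({x | p (k ≤ exceedances t x)}.indicator 1)
      (fun q => ({u | p (t < u)}.indicator 1) q.1) (measurable_one.indicator hm1)
      ((measurable_one.indicator hm2).comp measurable_fst)
      (fun σ x => by simp [Set.indicator_apply, exceedances_comp_perm])
      (fun q hq => by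
        have h := le_exceedances_iff e hq t
        have h1 : glue e q (e (.inl ())) = q.1 := by simp [glue]
        rw [h1] at h
        simp only [Set.indicator_apply, Set.mem_ofPred_eq, Pi.one_apply, k, h])
    rw [lintegral_indicator_one hm1] at h
    have hmeas : Measurable fun q : ℝ × (Fin m → ℝ) =>
        {u | p (t < u)}.indicator (1 : ℝ → ENNReal) q.1 :=
      (measurable_one.indicator hm2).comp measurable_fst
    rw [h, lintegral_prod _ hmeas.aemeasurable]
    simp [lintegral_indicator_one hm2]
  have hexp : ∀ s : ℝ, n * Real.exp (-(a + s)) = k * Real.exp (-s) := by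
    intro s
    rw [neg_add, Real.exp_add, Real.exp_neg a, Real.exp_log hn0]
    have : (n : ℝ) ≠ 0 := by rintro h; simp [h] at hn0
    field_simp
  have he := Real.exp_one_gt_d9
  have he' := Real.exp_one_lt_d9
  have hinv : Real.exp (-1) ≤ 3 / 8 := by
    rw [Real.exp_neg, inv_le_comm₀ (by positivity) (by norm_num)]
    linarith
  have hup : τ {u | a + 1 < u} ≤ ENNReal.ofReal (1 / k) := by
    have h1 := measure_exceedances_le (n := n) (t := a + 1) (δ := k * (5 / 8)) (by linarith)
      (by positivity)
    have h2 : τ {u | a + 1 < u} = ν {x | k ≤ exceedances (a + 1) x} := key (a + 1) id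
    rw [h2]
    refine (measure_mono ?_).trans (h1.trans (ENNReal.ofReal_le_ofReal ?_))
    · intro x hx
      have hx : k ≤ exceedances (a + 1) x := hx
      simp only [Set.mem_ofPred_eq, hexp]
      refine le_trans ?_ (le_abs_self _)
      nlinarith
    · rw [hexp, div_le_div_iff₀ (by positivity) hk]
      have : 0 < k ^ 2 := by positivity
      nlinarith
  have hlow : τ {u | u ≤ a - 1} ≤ ENNReal.ofReal (1 / k) := by
    have h1 := measure_exceedances_le (n := n) (t := a - 1) (δ := k * (Real.exp 1 - 1))
      (by linarith) (mul_pos hk (by linarith))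
    have h2 : {u : ℝ | u ≤ a - 1} = {u | Not (a - 1 < u)} := by ext; simp
    have h3 : n * Real.exp (-(a - 1)) = k * Real.exp 1 := by
      have := hexp (-1)
      rwa [← sub_eq_add_neg, neg_neg] at this
    rw [h2, key (a - 1) Not]
    refine (measure_mono ?_).trans (h1.trans (ENNReal.ofReal_le_ofReal ?_))
    · intro x hx
      have hx : ¬ k ≤ exceedances (a - 1) x := hx
      push Not at hx
      simp only [Set.mem_ofPred_eq, h3]
      refine le_trans ?_ (neg_le_abs _)
      nlinarith
    · rw [h3, div_le_div_iff₀ (by have : 0 < Real.exp 1 - 1 := by linarith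
                                  positivity) hk]
      have h4 : Real.exp 1 ≤ (Real.exp 1 - 1) ^ 2 := by nlinarith
      have : 0 < k ^ 2 := by positivity
      nlinarith
  calc τ {t | 1 < |t - a|} ≤ τ ({u | a + 1 < u} ∪ {u | u ≤ a - 1}) := by
        refine measure_mono fun t ht => ?_
        rcases lt_abs.1 (show 1 < |t - a| from ht) with h | h
        · left; simp only [Set.mem_ofPred_eq]; linarith
        · right; simp only [Set.mem_ofPred_eq]; linarith
    _ ≤ ENNReal.ofReal (1 / k) + ENNReal.ofReal (1 / k) :=
        (measure_union_le _ _).trans (add_le_add hup hlow)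
    _ = ENNReal.ofReal (2 / k) := by
        rw [← ENNReal.ofReal_add (by positivity) (by positivity)]
        ring_nf

end

/-! ### The norming constants -/

theorem abs_log_one_add_sub_le {x : ℝ} (hx : 0 ≤ x) : |Real.log (1 + x) - x| ≤ x ^ 2 / 2 := by
  have h1 := Real.log_le_sub_one_of_pos (show 0 < 1 + x by linarith)
  have h2 := Real.le_log_one_add_of_nonneg hx
  have h3 : x - x ^ 2 / 2 ≤ 2 * x / (x + 2) := by
    rw [le_div_iff₀ (by linarith)]
    have : 0 ≤ x ^ 3 := by positivity
    nlinarith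
  rw [abs_le]
  constructor <;> nlinarith [sq_nonneg x]

theorem le_log_factorial (k : ℕ) :
    (k : ℝ) * Real.log k - k ≤ Real.log k.factorial := by
  induction k with
  | zero => simp
  | succ k ih =>
    rcases Nat.eq_zero_or_pos k with rfl | hk
    · simp
    have hk' : (0 : ℝ) < k := by exact_mod_cast hk
    rw [Nat.factorial_succ, Nat.cast_mul, Real.log_mul (by positivity) (by positivity)]
    have h := Real.log_le_sub_one_of_pos (show 0 < ((k : ℝ) + 1) / k by positivity)
    rw [Real.log_div (by positivity) hk'.ne'] at h
    have h2 : (k : ℝ) * (((k : ℝ) + 1) / k - 1) = 1 := by field_simp; ring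
    have h3 := mul_le_mul_of_nonneg_left h hk'.le
    push_cast
    nlinarith

theorem log_factorial_le {k : ℕ} (hk : 1 ≤ k) :
    Real.log k.factorial ≤ k * Real.log k - k + 1 + Real.log k := by
  induction k, hk using Nat.le_induction with
  | base => simp
  | succ k hk ih =>
    have hk' : (0 : ℝ) < k := by exact_mod_cast hk
    rw [Nat.factorial_succ, Nat.cast_mul, Real.log_mul (by positivity) (by positivity)]
    have h := Real.log_le_sub_one_of_pos (show 0 < (k : ℝ) / (k + 1) by positivity)
    rw [Real.log_div hk'.ne' (by positivity)] at h
    have h2 : ((k : ℝ) + 1) * ((k : ℝ) / (k + 1) - 1) = -1 := by field_simp; ring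
    have h3 := mul_le_mul_of_nonneg_left h (show 0 ≤ (k : ℝ) + 1 by positivity)
    push_cast
    nlinarith

theorem sum_log_div_eq (m : ℕ) :
    ∑ i ∈ Finset.Icc 1 m, Real.log (((m + 1 : ℕ) : ℝ) / i) =
      (m + 1 : ℕ) * Real.log (m + 1 : ℕ) - Real.log (m + 1).factorial := by
  have h1 : ∀ i ∈ Finset.Icc 1 m, Real.log (((m + 1 : ℕ) : ℝ) / i) =
      Real.log (m + 1 : ℕ) - Real.log i := by
    intro i hi
    have : (i : ℝ) ≠ 0 := by
      have := (Finset.mem_Icc.1 hi).1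
      positivity
    rw [Real.log_div (by positivity) this]
  have h2 : Real.log m.factorial = ∑ i ∈ Finset.Icc 1 m, Real.log i := by
    have hIcc : Finset.Icc 1 m = Finset.Ico 1 (m + 1) := by ext; simp
    rw [hIcc, ← Finset.prod_Ico_id_eq_factorial, Nat.cast_prod, Real.log_prod]
    intro i hi
    have := (Finset.mem_Ico.1 hi).1
    positivity
  rw [Finset.sum_congr rfl h1, Finset.sum_sub_distrib, ← h2, Nat.factorial_succ, Nat.cast_mul,
    Real.log_mul (by positivity) (by positivity)]
  simp
  ring

theorem abs_sum_log_div_sub_le (m : ℕ) :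
    |∑ i ∈ Finset.Icc 1 m, Real.log (((m + 1 : ℕ) : ℝ) / i) - m| ≤
      1 + Real.log (m + 1 : ℕ) := by
  have h1 := le_log_factorial (m + 1)
  have h2 := log_factorial_le (k := m + 1) (by omega)
  have h3 : 0 ≤ Real.log (m + 1 : ℕ) := Real.log_natCast_nonneg _
  rw [sum_log_div_eq, abs_le]
  have : ((m + 1 : ℕ) : ℝ) = m + 1 := by push_cast; ring
  constructor <;> linarith

theorem sum_inv_sqrt_le (m : ℕ) : ∑ i ∈ Finset.Icc 1 m, (√(i : ℝ))⁻¹ ≤ 2 * √(m : ℝ) := by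
  induction m with
  | zero => simp
  | succ m ih =>
    rw [Finset.sum_Icc_succ_top (by omega)]
    have h0 : 0 < √((m + 1 : ℕ) : ℝ) := Real.sqrt_pos.2 (by positivity)
    have h1 : √(m : ℝ) ≤ √((m + 1 : ℕ) : ℝ) := Real.sqrt_le_sqrt (by push_cast; linarith)
    have h2 : √((m + 1 : ℕ) : ℝ) ^ 2 = m + 1 := by
      rw [Real.sq_sqrt (by positivity)]; push_cast; ring
    have h3 : √(m : ℝ) ^ 2 = m := Real.sq_sqrt (by positivity)
    have h4 : (√((m + 1 : ℕ) : ℝ))⁻¹ ≤ 2 * √((m + 1 : ℕ) : ℝ) - 2 * √(m : ℝ) := by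
      rw [inv_le_iff_one_le_mul₀ h0]
      nlinarith [sq_nonneg (√((m + 1 : ℕ) : ℝ) - √(m : ℝ))]
    linarith

theorem log_sq_le {y : ℝ} (hy : 1 ≤ y) : Real.log y ^ 2 ≤ 16 * √y := by
  have h := Real.log_le_rpow_div (show 0 ≤ y by linarith) (show (0:ℝ) < 1 / 4 by norm_num)
  have h0 := Real.log_nonneg hy
  have h1 : (y ^ (1 / 4 : ℝ)) ^ 2 = √y := by
    rw [Real.sqrt_eq_rpow, ← Real.rpow_natCast, ← Real.rpow_mul (by linarith)]
    norm_num
  calc Real.log y ^ 2 ≤ (y ^ (1 / 4 : ℝ) / (1 / 4)) ^ 2 := by gcongr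
    _ = 16 * √y := by rw [div_pow, h1]; ring

theorem sum_log_div_sq_le (m : ℕ) :
    ∑ i ∈ Finset.Icc 1 m, Real.log (((m + 1 : ℕ) : ℝ) / i) ^ 2 ≤ 32 * (m + 1 : ℕ) := by
  have h : ∀ i ∈ Finset.Icc 1 m, Real.log (((m + 1 : ℕ) : ℝ) / i) ^ 2 ≤
      16 * √((m + 1 : ℕ) : ℝ) * (√(i : ℝ))⁻¹ := by
    intro i hi
    obtain ⟨h1, h2⟩ := Finset.mem_Icc.1 hi
    have hi0 : (0 : ℝ) < i := by exact_mod_cast h1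
    have : (1 : ℝ) ≤ ((m + 1 : ℕ) : ℝ) / i := by
      rw [one_le_div hi0]
      exact_mod_cast (by omega)
    refine (log_sq_le this).trans_eq ?_
    rw [Real.sqrt_div (by positivity), div_eq_mul_inv, mul_assoc]
  refine (Finset.sum_le_sum h).trans ?_
  rw [← Finset.mul_sum]
  have h1 := sum_inv_sqrt_le m
  have h2 : √(m : ℝ) ≤ √((m + 1 : ℕ) : ℝ) := Real.sqrt_le_sqrt (by push_cast; linarith)
  calc 16 * √((m + 1 : ℕ) : ℝ) * ∑ i ∈ Finset.Icc 1 m, (√(i : ℝ))⁻¹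
      ≤ 16 * √((m + 1 : ℕ) : ℝ) * (2 * √((m + 1 : ℕ) : ℝ)) := by gcongr; linarith
    _ = 32 * (√((m + 1 : ℕ) : ℝ) * √((m + 1 : ℕ) : ℝ)) := by ring
    _ = 32 * (m + 1 : ℕ) := by rw [Real.mul_self_sqrt (by positivity)]

/-- The denominator of the Hill-type estimator based on the `m + 1` largest values. -/
noncomputable def hillNorm (n m : ℕ) : ℝ :=
  ∑ i ∈ Finset.Icc 1 m, (log₂ ((n : ℝ) / i) - log₂ ((n : ℝ) / (m + 1 : ℕ)))

/-- The denominator is close to `m / log (n / (m + 1))`: its terms are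
`log (1 + log (k / i) / log (n / k))` with `k = m + 1`, and `∑ log (k / i)` is close to `m`. -/
theorem abs_mul_hillNorm_sub_le {n m : ℕ} (ha : 0 < Real.log ((n : ℝ) / (m + 1 : ℕ))) :
    |Real.log ((n : ℝ) / (m + 1 : ℕ)) * hillNorm n m - m| ≤
      1 + Real.log (m + 1 : ℕ) + 16 * (m + 1 : ℕ) / Real.log ((n : ℝ) / (m + 1 : ℕ)) := by
  set k : ℝ := ((m + 1 : ℕ) : ℝ)
  set a := Real.log ((n : ℝ) / k)
  have hk : 0 < k := by positivity
  have hn : (n : ℝ) ≠ 0 := by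
    rintro h
    simp [a, h] at ha
  have hterm : ∀ i ∈ Finset.Icc 1 m,
      |a * (log₂ ((n : ℝ) / i) - log₂ ((n : ℝ) / k)) - Real.log (k / i)| ≤
        Real.log (k / i) ^ 2 / (2 * a) := by
    intro i hi
    obtain ⟨h1, h2⟩ := Finset.mem_Icc.1 hi
    have hi0 : (0 : ℝ) < i := by exact_mod_cast h1
    have hki : 1 ≤ k / i := by
      rw [one_le_div hi0]
      exact Nat.cast_le.2 (by omega)
    have hl : 0 ≤ Real.log (k / i) := Real.log_nonneg hki
    have hx : 0 ≤ Real.log (k / i) / a := by positivity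
    have he : log₂ ((n : ℝ) / i) - log₂ ((n : ℝ) / k) = Real.log (1 + Real.log (k / i) / a) := by
      have h3 : Real.log ((n : ℝ) / i) = a + Real.log (k / i) := by
        simp only [a]
        rw [← Real.log_mul (by positivity) (by positivity)]
        congr 1
        field_simp
      unfold log₂
      rw [h3, ← Real.log_div (by positivity) ha.ne']
      congr 1
      field_simp
    have h4 := abs_log_one_add_sub_le hx
    rw [he]
    have h5 : a * Real.log (1 + Real.log (k / i) / a) - Real.log (k / i) =
        a * (Real.log (1 + Real.log (k / i) / a) - Real.log (k / i) / a) := by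
      field_simp
    rw [h5, abs_mul, abs_of_pos ha]
    calc a * |Real.log (1 + Real.log (k / i) / a) - Real.log (k / i) / a|
        ≤ a * ((Real.log (k / i) / a) ^ 2 / 2) := by gcongr
      _ = Real.log (k / i) ^ 2 / (2 * a) := by field_simp
  have h1 : |a * hillNorm n m - ∑ i ∈ Finset.Icc 1 m, Real.log (k / i)| ≤ 16 * k / a := by
    unfold hillNorm
    rw [Finset.mul_sum, ← Finset.sum_sub_distrib]
    refine (Finset.abs_sum_le_sum_abs _ _).trans ((Finset.sum_le_sum hterm).trans ?_)
    rw [← Finset.sum_div, div_le_div_iff₀ (by positivity) ha]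
    have := sum_log_div_sq_le m
    have h6 : (∑ i ∈ Finset.Icc 1 m, Real.log (k / i) ^ 2) * a ≤ 32 * k * a := by gcongr
    linarith
  have h2 := abs_sum_log_div_sub_le m
  have h3 := abs_sub_le (a * hillNorm n m) (∑ i ∈ Finset.Icc 1 m, Real.log (k / i)) m
  linarith

/-! ### Approximation of the estimator by a normalized sum -/

/-- The sum of the log-excesses, for the values of the quantile function `Y` at a pivot `t` and at
the points exceeding it by `f j`. -/
noncomputable def pivotLogExcess {m : ℕ} (Y : ℝ → ℝ) (t : ℝ) (f : Fin m → ℝ) : ℝ :=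
  ∑ j, (Real.log (Y (t + f j)) - Real.log (Y t))

/-- The log-excesses are linearized to `θ * f j / t`. The bound on the sum of squares keeps every
ratio `(t + f j) / t` below `2`, where the hypothesis on `Y` applies. -/
theorem abs_pivotLogExcess_sub_le {m : ℕ} {Y b : ℝ → ℝ} {θ t : ℝ} (hθ : 0 < θ) (ht : 0 < t)
    (hY : ∀ s, 1 < s → s ≤ 2 →
      |Real.log (Y (s * t)) - Real.log (Y t) - θ * Real.log s| ≤ 2 * |b t| * (s - 1))
    {f : Fin m → ℝ} (hf : ∀ j, 0 < f j) (hQ : ∑ j, f j ^ 2 ≤ t ^ 2) :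
    |pivotLogExcess Y t f - θ * ((∑ j, f j) / t)| ≤
      θ * ((∑ j, f j ^ 2) / (2 * t ^ 2)) + 2 * |b t| * ((∑ j, f j) / t) := by
  have hterm : ∀ j, |Real.log (Y (t + f j)) - Real.log (Y t) - θ * (f j / t)| ≤
      θ * (f j ^ 2 / (2 * t ^ 2)) + 2 * |b t| * (f j / t) := by
    intro j
    have hx : 0 < f j / t := div_pos (hf j) ht
    have hle : f j ≤ t := by
      have h1 : f j ^ 2 ≤ t ^ 2 :=
        (Finset.single_le_sum (f := fun j => f j ^ 2) (fun i _ => sq_nonneg _)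
          (Finset.mem_univ j)).trans hQ
      exact le_of_sq_le_sq h1 ht.le
    have hx1 : f j / t ≤ 1 := (div_le_one ht).2 hle
    have h1 := hY (1 + f j / t) (by linarith) (by linarith)
    have he : (1 + f j / t) * t = t + f j := by field_simp
    rw [he, add_sub_cancel_left] at h1
    have h2 := abs_log_one_add_sub_le hx.le
    have h3 : |θ * Real.log (1 + f j / t) - θ * (f j / t)| ≤ θ * (f j ^ 2 / (2 * t ^ 2)) := by
      rw [← mul_sub, abs_mul, abs_of_pos hθ]
      gcongr
      refine h2.trans_eq ?_
      field_simp
    have h4 := abs_sub_le (Real.log (Y (t + f j)) - Real.log (Y t))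
      (θ * Real.log (1 + f j / t)) (θ * (f j / t))
    linarith
  unfold pivotLogExcess
  rw [Finset.sum_div, Finset.sum_div, Finset.mul_sum, Finset.mul_sum, Finset.mul_sum,
    ← Finset.sum_sub_distrib, ← Finset.sum_add_distrib]
  exact (Finset.abs_sum_le_sum_abs _ _).trans (Finset.sum_le_sum fun j _ => hterm j)

set_option maxHeartbeats 400000 in
/-- Replaces the estimator by a normalized sum. Here `A / D` is the estimator, `S` and `Q` are the
sums of the excesses and of their squares, `t` is the pivot, and `ε` is the relative error of `D` as
an approximation of `m / a`. -/
theorem abs_estimator_sub_le {m : ℕ} (hm : 1 ≤ m) {θ a t A D S Q β β' ε : ℝ} (hθ : 0 < θ)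
    (ht : 1 ≤ t) (ha : 0 < a) (hat : |t - a| ≤ 1) (hS : 0 ≤ S) (hQ : 0 ≤ Q)
    (hA : |A - θ * (S / t)| ≤ θ * (Q / (2 * t ^ 2)) + 2 * β' * (S / t))
    (hβ' : 0 ≤ β') (hβ : β' ≤ β) (hβt : 1 / t ≤ β) (hD : a * D = m * (1 + ε)) (hε : |ε| ≤ 1 / 2) :
    |√((m + 1 : ℕ) : ℝ) * (A / D - θ) - (√(m : ℝ))⁻¹ * (θ * S - m * θ)| ≤
      (2 * (θ + 4) * (√((m + 1 : ℕ) : ℝ) * β) + 2 * θ * (√((m + 1 : ℕ) : ℝ) * |ε|)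
        + θ / √(m : ℝ)) * (1 + S / m + Q / m) := by
  have hm0 : (0 : ℝ) < m := by exact_mod_cast hm
  set κ := √((m + 1 : ℕ) : ℝ)
  set μ := √(m : ℝ)
  have hκ : 0 ≤ κ := Real.sqrt_nonneg _
  have hμ : 0 < μ := Real.sqrt_pos.2 hm0
  have hκ2 : κ ^ 2 = m + 1 := by
    simp only [κ]; rw [Real.sq_sqrt (by positivity)]; push_cast; ring
  have hμ2 : μ ^ 2 = m := Real.sq_sqrt hm0.le
  have hε' := abs_le.1 hε
  have h1ε : 1 / 2 ≤ 1 + ε := by linarith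
  have hat' := abs_le.1 hat
  set s := S / m
  set q := Q / m
  have hs : 0 ≤ s := by positivity
  have hq : 0 ≤ q := by positivity
  have hSs : S = m * s := by simp only [s]; field_simp
  have hQq : Q = m * q := by simp only [q]; field_simp
  have hβ0 : 0 ≤ β := hβ'.trans hβ
  set u := a * A / m
  -- the numerator, after the normalization
  have hu : |u - θ * s| ≤ (θ + 4) * β * (s + q) := by
    have hat2 : a / t ≤ 2 := by rw [div_le_iff₀ (by linarith)]; linarith
    have hat0 : 0 ≤ a / t := by positivity
    have e1 : u - θ * s = a / m * (A - θ * (S / t)) + θ * s * (a / t - 1) := by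
      simp only [u, s]; field_simp; ring
    have e2 : |a / t - 1| ≤ β := by
      have : a / t - 1 = (a - t) / t := by field_simp
      rw [this, abs_div, abs_of_pos (show 0 < t by linarith), abs_sub_comm]
      exact (div_le_div_of_nonneg_right hat (by linarith)).trans hβt
    have e3 : |a / m * (A - θ * (S / t))| ≤ 2 * (θ * (q / 2 * β) + 2 * β * s) := by
      rw [abs_mul, abs_of_nonneg (by positivity : 0 ≤ a / (m:ℝ))]
      calc a / m * |A - θ * (S / t)|
          ≤ a / m * (θ * (Q / (2 * t ^ 2)) + 2 * β' * (S / t)) := by gcongr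
        _ = a / t * (θ * (q / 2 * (1 / t)) + 2 * β' * s) := by
            simp only [q, s]; field_simp
        _ ≤ 2 * (θ * (q / 2 * β) + 2 * β * s) := by gcongr
    have e4 : |θ * s * (a / t - 1)| ≤ θ * s * β := by
      rw [abs_mul, abs_of_nonneg (by positivity : 0 ≤ θ * s)]
      gcongr
    rw [e1]
    refine (abs_add_le _ _).trans ?_
    have h1 : 0 ≤ β * q := by positivity
    linarith
  have hAD : A / D = u / (1 + ε) := by
    have hD' : D = m * (1 + ε) / a := by rw [← hD]; field_simp
    rw [hD']; simp only [u]; field_simp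
  have hZ : κ * (A / D - θ) - κ * (θ * (s - 1)) =
      (κ * (u - θ * s) - θ * (κ * ε) * s) / (1 + ε) := by
    have : 1 + ε ≠ 0 := by linarith
    have hcancel : u / (1 + ε) * (1 + ε) = u := div_mul_cancel₀ _ this
    rw [hAD, eq_div_iff this]
    linear_combination κ * hcancel
  have hZ' : |κ * (A / D - θ) - κ * (θ * (s - 1))| ≤
      2 * (κ * ((θ + 4) * β * (s + q)) + θ * (κ * |ε|) * s) := by
    rw [hZ, abs_div, abs_of_pos (show 0 < 1 + ε by linarith), div_le_iff₀ (by linarith)]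
    have e1 : |κ * (u - θ * s) - θ * (κ * ε) * s| ≤
        κ * ((θ + 4) * β * (s + q)) + θ * (κ * |ε|) * s := by
      refine (abs_sub _ _).trans ?_
      rw [abs_mul, abs_of_nonneg hκ, abs_mul, abs_mul, abs_mul, abs_of_nonneg hκ,
        abs_of_nonneg hs, abs_of_pos hθ]
      gcongr
    have e2 : 0 ≤ κ * ((θ + 4) * β * (s + q)) + θ * (κ * |ε|) * s := by positivity
    have e3 := mul_le_mul_of_nonneg_left h1ε e2
    linarith
  -- replacing the factor `√(m + 1)` by `√m`
  have hW : |κ * (θ * (s - 1)) - μ⁻¹ * (θ * S - m * θ)| ≤ θ / μ * (1 + s) := by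
    have e1 : μ⁻¹ * (θ * S - m * θ) = μ * (θ * (s - 1)) := by
      rw [hSs, ← hμ2]; field_simp
    have e2 : |κ - μ| ≤ 1 / μ := by
      have e3 : μ ≤ κ := Real.sqrt_le_sqrt (by push_cast; linarith)
      rw [abs_of_nonneg (by linarith), le_div_iff₀ hμ]
      nlinarith [sq_nonneg (κ - μ)]
    have e4 : |s - 1| ≤ 1 + s := by rw [abs_le]; constructor <;> linarith
    rw [e1, ← sub_mul, abs_mul, abs_mul, abs_of_pos hθ]
    calc |κ - μ| * (θ * |s - 1|) ≤ 1 / μ * (θ * (1 + s)) := by gcongr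
      _ = θ / μ * (1 + s) := by ring
  refine (abs_sub_le _ (κ * (θ * (s - 1))) _).trans ((add_le_add hZ' hW).trans ?_)
  rw [← sub_nonneg]
  have hdiff : (2 * (θ + 4) * (κ * β) + 2 * θ * (κ * |ε|) + θ / μ) * (1 + s + q) -
      (2 * (κ * ((θ + 4) * β * (s + q)) + θ * (κ * |ε|) * s) + θ / μ * (1 + s)) =
      2 * (θ + 4) * (κ * β) + 2 * θ * (κ * |ε|) * (1 + q) + θ / μ * q := by ring
  rw [hdiff]
  positivity

/-! ### Moment bounds for the excesses -/

section

variable {m : ℕ}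

theorem ae_pos_pi : ∀ᵐ f ∂(Measure.pi fun _ : Fin m => expMeasure 1), ∀ j, 0 < f j :=
  ae_all_iff.2 fun j => (measurePreserving_eval (fun _ : Fin m => expMeasure 1)
    j).quasiMeasurePreserving.ae ae_pos_expMeasure

theorem lintegral_sum_pow_pi (p : ℕ) :
    ∫⁻ f, ENNReal.ofReal (∑ j, f j ^ p) ∂(Measure.pi fun _ : Fin m => expMeasure 1) =
      ENNReal.ofReal (m * p.factorial) := by
  set ν := Measure.pi fun _ : Fin m => expMeasure 1
  have hmp : ∀ j, MeasurePreserving (fun f : Fin m → ℝ => f j) ν (expMeasure 1) := fun j =>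
    measurePreserving_eval (fun _ : Fin m => expMeasure 1) j
  calc ∫⁻ f, ENNReal.ofReal (∑ j, f j ^ p) ∂ν
      = ∫⁻ f, ∑ j, ENNReal.ofReal (f j ^ p) ∂ν := by
        refine lintegral_congr_ae ?_
        filter_upwards [ae_pos_pi] with f hf
        exact ENNReal.ofReal_sum_of_nonneg fun j _ => by have := hf j; positivity
    _ = ∑ j : Fin m, ∫⁻ f, ENNReal.ofReal (f j ^ p) ∂ν :=
        lintegral_finsetSum _ fun j _ => by fun_prop
    _ = ∑ _j : Fin m, ENNReal.ofReal p.factorial := by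
        refine Finset.sum_congr rfl fun j _ => ?_
        rw [← lintegral_pow_expMeasure p,
          ← (hmp j).lintegral_comp (f := fun x => ENNReal.ofReal (x ^ p)) (by fun_prop)]
    _ = ENNReal.ofReal (m * p.factorial) := by
        rw [ENNReal.ofReal_mul (by positivity)]
        simp

theorem measure_le_sum_sq {x : ℝ} (hx : 0 < x) :
    (Measure.pi fun _ : Fin m => expMeasure 1) {f | x ≤ ∑ j, f j ^ 2} ≤
      ENNReal.ofReal (2 * m / x) := by
  have hmeas : Measurable fun f : Fin m → ℝ => ENNReal.ofReal (∑ j, f j ^ 2) := by fun_prop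
  have h := meas_ge_le_lintegral_div (μ := Measure.pi fun _ : Fin m => expMeasure 1)
    hmeas.aemeasurable (ε := ENNReal.ofReal x)
    (by simpa using hx) ENNReal.ofReal_ne_top
  rw [lintegral_sum_pow_pi 2, ← ENNReal.ofReal_div_of_pos hx] at h
  refine (measure_mono fun f hf => ?_).trans (h.trans_eq ?_)
  · exact ENNReal.ofReal_le_ofReal hf
  · norm_num [Nat.factorial, mul_comm]

theorem measure_le_one_add_means (hm : 1 ≤ m) {x : ℝ} (hx : 0 < x) :
    (Measure.pi fun _ : Fin m => expMeasure 1)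
        {f | x ≤ 1 + (∑ j, f j) / m + (∑ j, f j ^ 2) / m} ≤ ENNReal.ofReal (4 / x) := by
  set ν := Measure.pi fun _ : Fin m => expMeasure 1
  have hm0 : (0 : ℝ) < m := by exact_mod_cast hm
  have h := meas_ge_le_lintegral_div (μ := ν)
    (f := fun f => ENNReal.ofReal (1 + (∑ j, f j) / m + (∑ j, f j ^ 2) / m)) (by fun_prop)
    (ε := ENNReal.ofReal x) (by simpa using hx) ENNReal.ofReal_ne_top
  have h1 : ∫⁻ f, ENNReal.ofReal (1 + (∑ j, f j) / m + (∑ j, f j ^ 2) / m) ∂ν =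
      ENNReal.ofReal 4 := by
    have e1 := lintegral_sum_pow_pi (m := m) 1
    have e2 := lintegral_sum_pow_pi (m := m) 2
    simp only [pow_one] at e1
    calc ∫⁻ f, ENNReal.ofReal (1 + (∑ j, f j) / m + (∑ j, f j ^ 2) / m) ∂ν
        = ∫⁻ f, (1 + ENNReal.ofReal (m : ℝ)⁻¹ * ENNReal.ofReal (∑ j, f j) +
            ENNReal.ofReal (m : ℝ)⁻¹ * ENNReal.ofReal (∑ j, f j ^ 2)) ∂ν := by
          refine lintegral_congr_ae ?_
          filter_upwards [ae_pos_pi] with f hf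
          have s1 : 0 ≤ ∑ j, f j := Finset.sum_nonneg fun j _ => (hf j).le
          have s2 : 0 ≤ ∑ j, f j ^ 2 := Finset.sum_nonneg fun j _ => sq_nonneg _
          rw [ENNReal.ofReal_add (by positivity) (by positivity),
            ENNReal.ofReal_add (by positivity) (by positivity), ENNReal.ofReal_one,
            ← ENNReal.ofReal_mul (by positivity), ← ENNReal.ofReal_mul (by positivity)]
          ring_nf
      _ = 1 + ENNReal.ofReal (m : ℝ)⁻¹ * ENNReal.ofReal (m * (1 : ℕ).factorial) +
            ENNReal.ofReal (m : ℝ)⁻¹ * ENNReal.ofReal (m * (2 : ℕ).factorial) := by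
          rw [lintegral_add_left (by fun_prop), lintegral_add_left (by fun_prop),
            lintegral_const_mul _ (by fun_prop), lintegral_const_mul _ (by fun_prop), e1, e2]
          simp
      _ = ENNReal.ofReal 4 := by
          rw [← ENNReal.ofReal_mul (by positivity), ← ENNReal.ofReal_mul (by positivity),
            ← ENNReal.ofReal_one, ← ENNReal.ofReal_add (by positivity) (by positivity),
            ← ENNReal.ofReal_add (by positivity) (by positivity)]
          congr 1
          simp only [Nat.factorial]
          push_cast
          field_simp
          norm_num
  rw [h1, ← ENNReal.ofReal_div_of_pos hx] at h
  refine (measure_mono fun f hf => ?_).trans h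
  exact ENNReal.ofReal_le_ofReal hf

/-! ### Asymptotics of the norming constants -/

/-- The deterministic consequences of the growth condition `√k = o(log n)`, where `k = m + 1`: the
level `log (n / k)` is of order `log n`, and `hillNorm` is equivalent to `m / log (n / k)` up to a
relative error `o(1 / √k)`. -/
theorem tendsto_hillNorm_error {m : ℕ → ℕ} (hm : Tendsto m atTop atTop)
    (hL : Tendsto (fun n : ℕ => √((m n + 1 : ℕ) : ℝ) * (1 / Real.log n)) atTop (𝓝 0)) :
    (∀ᶠ n : ℕ in atTop, Real.log n / 2 + 1 ≤ Real.log ((n : ℝ) / (m n + 1 : ℕ)) ∧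
      Real.log ((n : ℝ) / (m n + 1 : ℕ)) ≤ Real.log n - 1) ∧
    Tendsto (fun n : ℕ => √((m n + 1 : ℕ) : ℝ) *
      |Real.log ((n : ℝ) / (m n + 1 : ℕ)) * hillNorm n (m n) / m n - 1|) atTop (𝓝 0) := by
  have hlog : Tendsto (fun n : ℕ => Real.log n) atTop atTop :=
    Real.tendsto_log_atTop.comp tendsto_natCast_atTop_atTop
  have hk : Tendsto (fun n => ((m n + 1 : ℕ) : ℝ)) atTop atTop :=
    tendsto_natCast_atTop_atTop.comp ((tendsto_add_atTop_nat 1).comp hm)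
  have hloglog : ∀ᶠ n : ℕ in atTop, Real.log (Real.log n) ≤ Real.log n / 8 := by
    have h := hlog.eventually
      (Real.isLittleO_log_id_atTop.bound (show (0:ℝ) < 1 / 8 by norm_num))
    filter_upwards [h, hlog.eventually_ge_atTop 1] with n hn hn1
    simp only [id, Real.norm_eq_abs] at hn
    rw [abs_of_nonneg (Real.log_nonneg hn1), abs_of_nonneg (by linarith)] at hn
    linarith
  have hE : ∀ᶠ n : ℕ in atTop, Real.log n / 2 + 1 ≤ Real.log ((n : ℝ) / (m n + 1 : ℕ)) ∧
      Real.log ((n : ℝ) / (m n + 1 : ℕ)) ≤ Real.log n - 1 := by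
    filter_upwards [hloglog, hlog.eventually_ge_atTop 4, hk.eventually_ge_atTop 3,
      hL.eventually (eventually_le_nhds one_pos), eventually_ge_atTop 1] with n h1 h2 h3 h4 h5
    have hL0 : 0 < Real.log n := by linarith
    have hn0 : (0 : ℝ) < n := by exact_mod_cast h5
    have hk0 : (0 : ℝ) < ((m n + 1 : ℕ) : ℝ) := by positivity
    rw [Real.log_div hn0.ne' hk0.ne']
    have h6 : √((m n + 1 : ℕ) : ℝ) ≤ Real.log n := by
      rw [mul_one_div, div_le_one hL0] at h4
      exact h4
    have h7 : ((m n + 1 : ℕ) : ℝ) ≤ Real.log n ^ 2 := Real.sqrt_le_left (by linarith) |>.1 h6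
    have h8 : Real.log (m n + 1 : ℕ) ≤ 2 * Real.log (Real.log n) := by
      have := Real.log_le_log hk0 h7
      rwa [Real.log_pow, Nat.cast_ofNat] at this
    have h9 : 1 ≤ Real.log (m n + 1 : ℕ) := by
      rw [Real.le_log_iff_exp_le hk0]
      have := Real.exp_one_lt_d9
      linarith
    constructor <;> linarith
  refine ⟨hE, ?_⟩
  have hsqrt : Tendsto (fun n => √((m n + 1 : ℕ) : ℝ)) atTop atTop :=
    Real.tendsto_sqrt_atTop.comp hk
  have hlogk : Tendsto (fun n => Real.log (m n + 1 : ℕ) / √((m n + 1 : ℕ) : ℝ)) atTop (𝓝 0) := by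
    have h := (isLittleO_log_rpow_atTop (show (0:ℝ) < 1 / 2 by norm_num)).tendsto_div_nhds_zero
    have h2 := h.comp hk
    refine h2.congr fun n => ?_
    simp only [Function.comp, Real.sqrt_eq_rpow]
  have hbound : Tendsto (fun n : ℕ => 2 * ((√((m n + 1 : ℕ) : ℝ))⁻¹ +
      Real.log (m n + 1 : ℕ) / √((m n + 1 : ℕ) : ℝ)) +
      64 * (√((m n + 1 : ℕ) : ℝ) * (1 / Real.log n))) atTop (𝓝 0) := by
    simpa using (((tendsto_inv_atTop_zero.comp hsqrt).add hlogk).const_mul 2).add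
      (hL.const_mul 64)
  refine squeeze_zero' (.of_forall fun n => by positivity) ?_ hbound
  filter_upwards [hE, hm.eventually_ge_atTop 1, hlog.eventually_ge_atTop 4] with n hn hm1 hL4
  have ha : 0 < Real.log ((n : ℝ) / (m n + 1 : ℕ)) := by linarith [hn.1]
  have herr := abs_mul_hillNorm_sub_le ha
  have hL0 : 0 < Real.log n := by linarith
  set a := Real.log ((n : ℝ) / (m n + 1 : ℕ))
  set L := Real.log n
  have hm0 : (0 : ℝ) < m n := by exact_mod_cast hm1
  set k : ℝ := ((m n + 1 : ℕ) : ℝ)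
  have hk0 : 0 < k := by positivity
  have hlk : 0 ≤ Real.log k := Real.log_natCast_nonneg _
  have hkm : k ≤ 2 * m n := by
    simp only [k]; push_cast
    have : (1 : ℝ) ≤ m n := by exact_mod_cast hm1
    linarith
  set κ := √k
  have hκ : 0 < κ := Real.sqrt_pos.2 hk0
  have hκk : κ * κ = k := Real.mul_self_sqrt hk0.le
  have h1 : a * hillNorm n (m n) / m n - 1 = (a * hillNorm n (m n) - m n) / m n := by
    field_simp
  rw [h1, abs_div, abs_of_pos hm0]
  have h2 : 16 * k / a ≤ 32 * k / L := by
    rw [div_le_div_iff₀ ha hL0]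
    nlinarith [hn.1]
  calc κ * (|a * hillNorm n (m n) - m n| / m n)
      ≤ κ * ((1 + Real.log k + 32 * k / L) / (k / 2)) := by
        gcongr
        · linarith
        · linarith
    _ = 2 * (κ⁻¹ + Real.log k / κ) + 64 * (κ * (1 / L)) := by
        rw [← hκk]; field_simp; ring

/-! ### Convergence of the estimator in the exponential model -/

theorem measurable_pivotLogExcess {Y : ℝ → ℝ} (hY : Measurable Y) :
    Measurable fun q : ℝ × (Fin m → ℝ) => pivotLogExcess Y q.1 q.2 := by
  unfold pivotLogExcess
  refine Finset.measurable_sum _ fun j _ => ?_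
  have h1 : Measurable fun q : ℝ × (Fin m → ℝ) => Y (q.1 + q.2 j) := hY.comp (by fun_prop)
  have h2 : Measurable fun q : ℝ × (Fin m → ℝ) => Y q.1 := hY.comp (by fun_prop)
  exact (Real.measurable_log.comp h1).sub (Real.measurable_log.comp h2)

/-- The probability that the estimator, expressed through the pivot and the excesses over it, is not
close to a normalized sum of the excesses. -/
theorem measure_estimator_sub_le {n : ℕ} (hm : 1 ≤ m) {Y b : ℝ → ℝ} {θ a β ε c δ : ℝ}
    (hθ : 0 < θ) (τ : Measure ℝ) [IsProbabilityMeasure τ] (ha : 2 ≤ a)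
    (hτ : τ {t | 1 < |t - a|} ≤ ENNReal.ofReal (2 / (m + 1)))
    (hY : ∀ t, |t - a| ≤ 1 → ∀ s, 1 < s → s ≤ 2 →
      |Real.log (Y (s * t)) - Real.log (Y t) - θ * Real.log s| ≤ 2 * |b t| * (s - 1))
    (hb : ∀ t, |t - a| ≤ 1 → |b t| ≤ β) (hβ : 1 / (a - 1) ≤ β)
    (hD : a * hillNorm n m = m * (1 + ε)) (hε : |ε| ≤ 1 / 2)
    (hc : 2 * (θ + 4) * (√((m + 1 : ℕ) : ℝ) * β) + 2 * θ * (√((m + 1 : ℕ) : ℝ) * |ε|)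
        + θ / √(m : ℝ) ≤ c) (hδ : 0 < δ) :
    (τ.prod (Measure.pi fun _ : Fin m => expMeasure 1))
      {q | δ ≤ |√((m + 1 : ℕ) : ℝ) * (pivotLogExcess Y q.1 q.2 / hillNorm n m - θ) -
        (√(m : ℝ))⁻¹ * (θ * ∑ j, q.2 j - m * θ)|} ≤
      ENNReal.ofReal (2 / (m + 1)) + ENNReal.ofReal (2 * m / (a - 1) ^ 2) +
        ENNReal.ofReal (4 * c / δ) := by
  set ν := Measure.pi fun _ : Fin m => expMeasure 1
  have hm0 : (0 : ℝ) < m := by exact_mod_cast hm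
  have hβ0 : 0 < β := lt_of_lt_of_le (by have : 0 < a - 1 := by linarith
                                         positivity) hβ
  have hc0 : 0 < c := lt_of_lt_of_le (by positivity) hc
  set A₁ : Set (ℝ × (Fin m → ℝ)) := {t | 1 < |t - a|} ×ˢ Set.univ
  set A₂ : Set (ℝ × (Fin m → ℝ)) := Set.univ ×ˢ {f | (a - 1) ^ 2 ≤ ∑ j, f j ^ 2}
  set A₃ : Set (ℝ × (Fin m → ℝ)) :=
    Set.univ ×ˢ {f | δ / c ≤ 1 + (∑ j, f j) / m + (∑ j, f j ^ 2) / m}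
  have hA₁ : τ.prod ν A₁ ≤ ENNReal.ofReal (2 / (m + 1)) := by
    simpa [A₁, Measure.prod_prod] using hτ
  have hA₂ : τ.prod ν A₂ ≤ ENNReal.ofReal (2 * m / (a - 1) ^ 2) := by
    have h := measure_le_sum_sq (m := m) (x := (a - 1) ^ 2)
      (by have : 0 < a - 1 := by linarith
          positivity)
    simpa [A₂, Measure.prod_prod] using h
  have hA₃ : τ.prod ν A₃ ≤ ENNReal.ofReal (4 * c / δ) := by
    have h := measure_le_one_add_means hm (x := δ / c) (by positivity)
    have h' : 4 / (δ / c) = 4 * c / δ := by field_simp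
    rw [h'] at h
    simpa [A₃, Measure.prod_prod] using h
  have hpos : ∀ᵐ q ∂(τ.prod ν), ∀ j, 0 < q.2 j :=
    Measure.quasiMeasurePreserving_snd.ae ae_pos_pi
  refine (measure_mono_ae (t := A₁ ∪ A₂ ∪ A₃) ?_).trans
    ((measure_union_le _ _).trans (add_le_add ((measure_union_le _ _).trans
      (add_le_add hA₁ hA₂)) hA₃))
  filter_upwards [hpos] with q hq hmem
  by_contra hnot
  have hnot' : q ∉ A₁ ∪ A₂ ∪ A₃ := hnot
  simp only [A₁, A₂, A₃, Set.mem_union, Set.mem_prod, Set.mem_ofPred_eq, Set.mem_univ, and_true,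
    true_and, not_or, not_lt, not_le] at hnot'
  obtain ⟨⟨h1, h2⟩, h3⟩ := hnot'
  have h1' := abs_le.1 h1
  have ht : 1 ≤ q.1 := by linarith
  have hQ : ∑ j, q.2 j ^ 2 ≤ q.1 ^ 2 := h2.le.trans (by gcongr <;> linarith)
  have hS0 : 0 ≤ ∑ j, q.2 j := Finset.sum_nonneg fun j _ => (hq j).le
  have hQ0 : 0 ≤ ∑ j, q.2 j ^ 2 := Finset.sum_nonneg fun j _ => sq_nonneg _
  have hA := abs_pivotLogExcess_sub_le hθ (by linarith) (hY q.1 h1) hq hQ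
  have hβt : 1 / q.1 ≤ β :=
    (one_div_le_one_div_of_le (by linarith) (by linarith)).trans hβ
  have hfin := abs_estimator_sub_le hm hθ ht (by linarith) h1 hS0 hQ0 hA (abs_nonneg _)
    (hb q.1 h1) hβt hD hε
  have hG : 0 ≤ 1 + (∑ j, q.2 j) / m + (∑ j, q.2 j ^ 2) / m := by positivity
  have h4 : δ ≤ c * (1 + (∑ j, q.2 j) / m + (∑ j, q.2 j ^ 2) / m) :=
    (show δ ≤ _ from hmem).trans (hfin.trans (by gcongr))
  rw [lt_div_iff₀ hc0] at h3
  linarith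

end

/-! ### The law of the estimator -/

theorem measurable_orderStat {Ω : Type*} [MeasurableSpace Ω] {X : ℕ → Ω → ℝ}
    (hX : ∀ i, Measurable (X i)) (n j : ℕ) :
    Measurable fun ω => orderStat (fun i => X i ω) n j := by
  by_cases hj : 1 ≤ j ∧ j ≤ n
  · have : (fun ω => orderStat (fun i => X i ω) n j) =
        fun ω => sorted (fun i : Fin n => X i ω) ⟨j - 1, by omega⟩ := by
      ext ω
      rw [orderStat, dif_pos hj]
      rfl
    rw [this]
    exact (measurable_sorted _).comp (measurable_pi_lambda _ fun i => hX i)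
  · simp only [orderStat, dif_neg hj]
    exact measurable_const

theorem measurable_hillEstimator {Ω : Type*} [MeasurableSpace Ω] {X : ℕ → Ω → ℝ}
    (hX : ∀ i, Measurable (X i)) (n k : ℕ) :
    Measurable fun ω => hillEstimator (fun i => X i ω) n k := by
  unfold hillEstimator
  exact (Finset.measurable_sum _ fun i _ =>
    (Real.measurable_log.comp (measurable_orderStat hX _ _)).sub
      (Real.measurable_log.comp (measurable_orderStat hX _ _))).div_const _

theorem measurable_pivot_estimator {Y : ℝ → ℝ} (hY : Measurable Y) (m : ℕ) (c d θ : ℝ) :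
    Measurable fun q : ℝ × (Fin m → ℝ) => c * (pivotLogExcess Y q.1 q.2 / d - θ) := by
  have := measurable_pivotLogExcess (m := m) hY
  fun_prop

/-- The law of the estimator, through the quantile coupling `X = Y(E)` and the pivot representation
of the exponential sample. -/
theorem exists_law_hillEstimator {Ω : Type*} [MeasurableSpace Ω] {P : Measure Ω}
    [IsProbabilityMeasure P] {X : ℕ → Ω → ℝ} (hX : ∀ i, Measurable (X i)) (hind : iIndepFun X P)
    {F : ℝ → ℝ} (hF : ∀ i x, P.real {ω | X i ω ≤ x} = F x) {n m r : ℕ} (hn : n = m + 1 + r)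
    (c θ : ℝ) :
    ∃ τ : Measure ℝ, IsProbabilityMeasure τ ∧
      (1 ≤ Real.log ((n : ℝ) / (m + 1)) →
        τ {t | 1 < |t - Real.log ((n : ℝ) / (m + 1))|} ≤ ENNReal.ofReal (2 / (m + 1))) ∧
      P.map (fun ω => c * (hillEstimator (fun i => X i ω) n (m + 1) - θ)) =
        (τ.prod (Measure.pi fun _ : Fin m => expMeasure 1)).map
          (fun q => c * (pivotLogExcess (invFailureRate F) q.1 q.2 / hillNorm n m - θ)) := by
  let e : Unit ⊕ (Fin m ⊕ Fin r) ≃ Fin n := Fintype.equivFinOfCardEq (by simp; omega)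
  obtain ⟨τ, hτ, hlaw⟩ := exists_law_pivot e
  refine ⟨τ, hτ, fun h => measure_pivot_le e hlaw h, ?_⟩
  have hFX : ∀ i x, (P.map (X i)).real (Set.Iic x) = F x := fun i x => by
    rw [map_measureReal_apply (hX i) measurableSet_Iic]
    exact hF i x
  have hprob : ∀ i, IsProbabilityMeasure (P.map (X i)) := fun i =>
    Measure.isProbabilityMeasure_map (hX i).aemeasurable
  set Y := invFailureRate F
  have hYm : Measurable Y := measurable_invFailureRate (hFX 0)
  have hYmono : MonotoneOn Y (Set.Ioi 0) := monotoneOn_invFailureRate (hFX 0)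
  have hmapY : ∀ i, P.map (X i) = (expMeasure 1).map Y := fun i =>
    (map_invFailureRate_expMeasure (hFX i)).symm
  have hr : r < n := by omega
  have hjoint : P.map (fun ω (i : Fin n) => X i ω) =
      (Measure.pi fun _ : Fin n => expMeasure 1).map (fun x => Y ∘ x) := by
    have hind' : iIndepFun (fun i : Fin n => X i) P := hind.precomp Fin.val_injective
    have h1 := (iIndepFun_iff_map_fun_eq_pi_map fun i : Fin n => (hX i).aemeasurable).1 hind'
    have h2 := Measure.pi_map_pi (μ := fun _ : Fin n => expMeasure 1) (f := fun _ => Y)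
      fun _ => hYm.aemeasurable
    rw [h1]
    simp only [hmapY]
    exact h2.symm
  set Φ : (Fin n → ℝ) → ℝ := fun v => c * (logExcess ⟨r, hr⟩ v / hillNorm n m - θ)
  have hΦ : Measurable Φ := by
    have := measurable_logExcess (n := n) ⟨r, hr⟩
    fun_prop
  have hψ : Measurable fun q : ℝ × (Fin m → ℝ) =>
      c * (pivotLogExcess Y q.1 q.2 / hillNorm n m - θ) :=
    measurable_pivot_estimator hYm m c _ θ
  have hYcomp : Measurable fun x : Fin n → ℝ => Y ∘ x :=
    measurable_pi_lambda _ fun i => hYm.comp (measurable_pi_apply i)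
  have hcomp : (fun ω => c * (hillEstimator (fun i => X i ω) n (m + 1) - θ)) =
      Φ ∘ fun ω (i : Fin n) => X i ω := by
    ext ω
    simp only [Φ, Function.comp]
    rw [hillEstimator_eq _ hr hn]
    rfl
  rw [hcomp, ← Measure.map_map hΦ (measurable_pi_lambda _ fun i => hX i), hjoint,
    Measure.map_map hΦ hYcomp]
  ext B hB
  have hB1 : Measurable (B.indicator (1 : ℝ → ENNReal)) := measurable_one.indicator hB
  rw [← lintegral_indicator_one hB, ← lintegral_indicator_one hB,
    lintegral_map hB1 (hΦ.comp hYcomp), lintegral_map hB1 hψ]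
  refine hlaw _ _ (hB1.comp (hΦ.comp hYcomp)) (hB1.comp hψ) (fun σ x => ?_) fun p hp => ?_
  · refine congrArg (B.indicator 1) ?_
    change Φ ((Y ∘ x) ∘ σ) = Φ (Y ∘ x)
    simp only [Φ, logExcess_comp_perm]
  · refine congrArg (B.indicator 1) ?_
    change Φ (Y ∘ glue e p) = _
    simp only [Φ, pivotLogExcess]
    rw [logExcess_of_mem_pivotSet e hr hYmono hp]
    simp [glue]

theorem tendstoInDistribution_of_eventually_map_eq {Ω Ω' Ω'' : Type*} [MeasurableSpace Ω]
    [MeasurableSpace Ω'] [MeasurableSpace Ω''] {P : Measure Ω} [IsProbabilityMeasure P]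
    {Q : Measure Ω'} [IsProbabilityMeasure Q] {R : Measure Ω''} [IsProbabilityMeasure R]
    {U : ℕ → Ω → ℝ} {V : ℕ → Ω' → ℝ} {Z : Ω'' → ℝ} (hV : ∀ n, AEMeasurable (V n) Q)
    (h : TendstoInDistribution U atTop Z (fun _ => P) R)
    (heq : ∀ᶠ n in atTop, Q.map (V n) = P.map (U n)) :
    TendstoInDistribution V atTop Z (fun _ => Q) R where
  forall_aemeasurable := hV
  aemeasurable_limit := h.aemeasurable_limit
  tendsto := by
    refine h.tendsto.congr' ?_
    filter_upwards [heq] with n hn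
    exact Subtype.ext hn.symm

/-- The central limit theorem for exponential variables with mean `θ`. -/
theorem tendstoInDistribution_exponential_sum (θ : ℝ) :
    TendstoInDistribution
      (fun (n : ℕ) (x : ℕ → ℝ) => (√(n : ℝ))⁻¹ * (∑ j ∈ Finset.range n, θ * x j - n * θ))
      atTop (id : ℝ → ℝ) (fun _ => Measure.infinitePi fun _ : ℕ => expMeasure 1)
      (gaussianReal 0 (θ ^ 2).toNNReal) := by
  set Q := Measure.infinitePi fun _ : ℕ => expMeasure 1
  have hmp : ∀ i, MeasurePreserving (fun x : ℕ → ℝ => x i) Q (expMeasure 1) := fun i =>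
    measurePreserving_eval_infinitePi (fun _ : ℕ => expMeasure 1) i
  have hmeas : ∀ i, Measurable fun x : ℕ → ℝ => θ * x i := fun i => by fun_prop
  have hlaw : ∀ i, Q.map (fun x : ℕ → ℝ => θ * x i) = (expMeasure 1).map (fun u => θ * u) := by
    intro i
    rw [← (hmp i).map_eq, Measure.map_map (by fun_prop) (by fun_prop)]
    rfl
  have hL2 : MemLp (fun u : ℝ => θ * u) 2 (expMeasure 1) := by
    have : MemLp (fun u : ℝ => u) 2 (expMeasure 1) := by
      refine (memLp_two_iff_integrable_sq (by fun_prop)).2 ?_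
      simpa using integrable_pow_expMeasure 2
    exact this.const_mul θ
  have hmean : Q[fun x : ℕ → ℝ => θ * x 0] = θ := by
    have h := integral_map (μ := Q) (φ := fun x : ℕ → ℝ => x 0) (f := fun u => θ * u)
      (measurable_pi_apply 0).aemeasurable (by fun_prop)
    rw [(hmp 0).map_eq] at h
    rw [← h, integral_const_mul, integral_id_expMeasure, mul_one]
  have hvar : Var[fun x : ℕ → ℝ => θ * x 0; Q] = θ ^ 2 := by
    have h := variance_map (μ := Q) (Y := fun x : ℕ → ℝ => x 0) (X := fun u => θ * u)
      (by fun_prop) (measurable_pi_apply 0).aemeasurable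
    rw [(hmp 0).map_eq, variance_const_mul] at h
    have h1 := variance_id_expMeasure
    change Var[fun u => u; expMeasure 1] = 1 at h1
    rw [h1, mul_one] at h
    exact h.symm
  have h := tendstoInDistribution_inv_sqrt_mul_sum_sub (P := Q)
    (P' := gaussianReal 0 (θ ^ 2).toNNReal) (X := fun i x => θ * x i) (Y := id) ?_ ?_ ?_ ?_
  · simpa only [hmean] using h
  · rw [hvar]
    exact HasLaw.id
  · exact hL2.comp_measurePreserving (hmp 0)
  · exact iIndepFun_infinitePi (P := fun _ : ℕ => expMeasure 1) (X := fun _ u => θ * u)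
      (fun _ => by fun_prop)
  · exact fun i => ⟨(hmeas i).aemeasurable, (hmeas 0).aemeasurable, by rw [hlaw, hlaw]⟩

theorem measurable_pivot_excesses (n m : ℕ) :
    Measurable fun ω : (ℕ → ℝ) × (ℕ → ℝ) => (ω.1 n, fun j : Fin m => ω.2 j) := by
  fun_prop

theorem measurable_pivot_estimator_comp {Y : ℝ → ℝ} (hY : Measurable Y) (n m : ℕ) (c d θ : ℝ) :
    Measurable fun ω : (ℕ → ℝ) × (ℕ → ℝ) =>
      c * (pivotLogExcess Y (ω.1 n) (fun j : Fin m => ω.2 j) / d - θ) := by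
  have h : Measurable fun ω : (ℕ → ℝ) × (ℕ → ℝ) =>
      pivotLogExcess Y (ω.1 n) (fun j : Fin m => ω.2 j) :=
    (measurable_pivotLogExcess (m := m) hY).comp (measurable_pivot_excesses n m)
  exact ((h.div_const _).sub_const _).const_mul _

/-- All the pivots and excesses, realized on a single probability space. -/
theorem measurePreserving_pivot_excesses (τ : ℕ → Measure ℝ) [∀ n, IsProbabilityMeasure (τ n)]
    (n m : ℕ) :
    MeasurePreserving (fun ω : (ℕ → ℝ) × (ℕ → ℝ) => (ω.1 n, fun j : Fin m => ω.2 j))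
      ((Measure.infinitePi τ).prod (Measure.infinitePi fun _ : ℕ => expMeasure 1))
      ((τ n).prod (Measure.pi fun _ : Fin m => expMeasure 1)) := by
  refine MeasurePreserving.prod (measurePreserving_eval_infinitePi τ n)
    (g := fun (x : ℕ → ℝ) (j : Fin m) => x j) ?_
  refine ⟨by fun_prop, ?_⟩
  have h : iIndepFun (fun (i : ℕ) (x : ℕ → ℝ) => x i)
      (Measure.infinitePi fun _ : ℕ => expMeasure 1) :=
    iIndepFun_infinitePi (P := fun _ : ℕ => expMeasure 1) (X := fun _ => id)
      (fun _ => by fun_prop)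
  have h1 := (iIndepFun_iff_map_fun_eq_pi_map fun i : Fin m =>
    (measurable_pi_apply (i : ℕ)).aemeasurable).1
    (h.precomp (Fin.val_injective (n := m)))
  rw [h1]
  congr
  ext1 i
  exact (measurePreserving_eval_infinitePi (fun _ : ℕ => expMeasure 1) _).map_eq

theorem map_pivot_estimator (τ : ℕ → Measure ℝ) [∀ n, IsProbabilityMeasure (τ n)]
    {Y : ℝ → ℝ} (hY : Measurable Y) (n m : ℕ) (c d θ : ℝ) :
    ((τ n).prod (Measure.pi fun _ : Fin m => expMeasure 1)).map
        (fun q => c * (pivotLogExcess Y q.1 q.2 / d - θ)) =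
      ((Measure.infinitePi τ).prod (Measure.infinitePi fun _ : ℕ => expMeasure 1)).map
        (fun ω => c * (pivotLogExcess Y (ω.1 n) (fun j : Fin m => ω.2 j) / d - θ)) := by
  rw [← (measurePreserving_pivot_excesses τ n m).map_eq,
    Measure.map_map (measurable_pivot_estimator hY m c d θ) (measurable_pivot_excesses n m)]
  simp only [Function.comp_def]

/-! ### Asymptotic normality -/

/-- Convergence in the exponential model, for pivots `t` with laws `τ n` concentrating near
`log (n / (m n + 1))` and independent exponential excesses. -/
theorem tendstoInMeasure_estimator_sub {κ : Measure ℝ} [IsProbabilityMeasure κ] {F : ℝ → ℝ}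
    (hF : ∀ x, κ.real (Set.Iic x) = F x) {θ ρ : ℝ} (hθ : 0 < θ) {ℓ b : ℝ → ℝ}
    (h1 : FirstOrder F θ ℓ) (h2 : SecondOrder ℓ b ρ) {m : ℕ → ℕ} (hm : Tendsto m atTop atTop)
    (hmb : Tendsto (fun n : ℕ => √((m n + 1 : ℕ) : ℝ) *
      max |b (Real.log (n : ℝ))| (1 / Real.log (n : ℝ))) atTop (𝓝 0))
    (τ : ℕ → Measure ℝ) [∀ n, IsProbabilityMeasure (τ n)]
    (hτ : ∀ᶠ n in atTop, τ n {t | 1 < |t - Real.log ((n : ℝ) / (m n + 1 : ℕ))|} ≤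
      ENNReal.ofReal (2 / (m n + 1))) :
    TendstoInMeasure ((Measure.infinitePi τ).prod (Measure.infinitePi fun _ : ℕ => expMeasure 1))
      ((fun (n : ℕ) (ω : (ℕ → ℝ) × (ℕ → ℝ)) => √((m n + 1 : ℕ) : ℝ) *
        (pivotLogExcess (invFailureRate F) (ω.1 n) (fun j : Fin (m n) => ω.2 j) /
          hillNorm n (m n) - θ)) -
        fun (n : ℕ) (ω : (ℕ → ℝ) × (ℕ → ℝ)) =>
          (√(m n : ℝ))⁻¹ * (∑ j ∈ Finset.range (m n), θ * ω.2 j - m n * θ)) atTop 0 := by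
  set B : ℕ → ℝ := fun n => max |b (Real.log (n : ℝ))| (1 / Real.log (n : ℝ))
  set r : ℕ → ℝ := fun n => √((m n + 1 : ℕ) : ℝ)
  have hr0 : ∀ n, 0 ≤ r n := fun n => Real.sqrt_nonneg _
  have hB0 : ∀ n, 0 ≤ B n := fun n => (abs_nonneg _).trans (le_max_left _ _)
  have hlog : Tendsto (fun n : ℕ => Real.log n) atTop atTop :=
    Real.tendsto_log_atTop.comp tendsto_natCast_atTop_atTop
  have hrL : Tendsto (fun n : ℕ => r n * (1 / Real.log n)) atTop (𝓝 0) :=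
    squeeze_zero (fun n => mul_nonneg (hr0 n) (one_div_nonneg.2 (Real.log_natCast_nonneg n)))
      (fun n => mul_le_mul_of_nonneg_left (le_max_right _ _) (hr0 n)) hmb
  obtain ⟨hlevel, herr⟩ := tendsto_hillNorm_error hm hrL
  obtain ⟨T₁, hT₁⟩ := h1.exists_abs_log_sub_le hF hθ h2
  obtain ⟨C, hC, T₂, hT₂⟩ := h2.exists_abs_le_mul hF hθ h1
  set a : ℕ → ℝ := fun n => Real.log ((n : ℝ) / (m n + 1 : ℕ))
  set ε : ℕ → ℝ := fun n => a n * hillNorm n (m n) / m n - 1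
  set c : ℕ → ℝ := fun n => 2 * (θ + 4) * ((2 + C) * (r n * B n)) + 2 * θ * (r n * |ε n|) +
    θ / √(m n : ℝ)
  have hsqrtm : Tendsto (fun n => √(m n : ℝ)) atTop atTop :=
    Real.tendsto_sqrt_atTop.comp (tendsto_natCast_atTop_atTop.comp hm)
  have hc : Tendsto c atTop (𝓝 0) := by
    have e1 := ((hmb.const_mul (2 + C)).const_mul (2 * (θ + 4))).add (herr.const_mul (2 * θ))
    have e2 := e1.add (hsqrtm.const_div_atTop θ)
    simp only [mul_zero, add_zero] at e2
    exact e2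
  rw [tendstoInMeasure_iff_norm]
  intro δ hδ
  have hlim : Tendsto (fun n => ENNReal.ofReal (2 / (m n + 1)) +
      ENNReal.ofReal (8 * (r n * (1 / Real.log n)) ^ 2) + ENNReal.ofReal (4 * c n / δ)) atTop
      (𝓝 0) := by
    have e1 : Tendsto (fun n => (2 : ℝ) / (m n + 1)) atTop (𝓝 0) :=
      (tendsto_atTop_add_const_right _ 1
        (tendsto_natCast_atTop_atTop.comp hm : Tendsto (fun n => (m n : ℝ)) atTop atTop)
        ).const_div_atTop 2
    have e2 : Tendsto (fun n => 8 * (r n * (1 / Real.log n)) ^ 2) atTop (𝓝 0) := by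
      simpa using (hrL.pow 2).const_mul 8
    have e3 : Tendsto (fun n => 4 * c n / δ) atTop (𝓝 0) := by
      simpa using (hc.const_mul 4).div_const δ
    simpa using ((ENNReal.tendsto_ofReal e1).add (ENNReal.tendsto_ofReal e2)).add
      (ENNReal.tendsto_ofReal e3)
  refine tendsto_of_tendsto_of_tendsto_of_le_of_le' tendsto_const_nhds hlim
    (.of_forall fun _ => zero_le) ?_
  filter_upwards [hτ, hlevel, hm.eventually_ge_atTop 1, hlog.eventually_ge_atTop 4,
    hlog.eventually_ge_atTop (2 * T₁), hlog.eventually_ge_atTop (2 * T₂),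
    herr.eventually (eventually_le_nhds (show (0:ℝ) < 1 / 2 by norm_num))]
    with n hτn hlevn hm1 hL4 hLT₁ hLT₂ hεn
  obtain ⟨hlev1, hlev2⟩ := hlevn
  set L := Real.log n
  have hm0 : (0 : ℝ) < m n := by exact_mod_cast hm1
  have hL0 : 0 < L := by linarith
  change L / 2 + 1 ≤ a n at hlev1
  change a n ≤ L - 1 at hlev2
  have hr1 : 1 ≤ r n := Real.one_le_sqrt.2 (by push_cast; linarith)
  have hε : |ε n| ≤ 1 / 2 := by
    have : |ε n| ≤ r n * |ε n| := le_mul_of_one_le_left (abs_nonneg _) hr1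
    exact this.trans hεn
  have hT : ∀ t, |t - a n| ≤ 1 → L / 2 ≤ t ∧ t ≤ L := fun t ht => by
    have := abs_le.1 ht
    constructor <;> linarith
  have hBL : 1 / L ≤ B n := le_max_right _ _
  have hb : ∀ t, |t - a n| ≤ 1 → |b t| ≤ (2 + C) * B n := fun t ht => by
    obtain ⟨ht1, ht2⟩ := hT t ht
    have ht0 : 0 < t := by linarith
    -- `t` is comparable with `log n`, so that the growth condition controls `b t`
    have h := hT₂ t (by linarith) (L / t) ((one_le_div ht0).2 ht2)
      ((div_le_iff₀ ht0).2 (by linarith))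
    rw [div_mul_cancel₀ _ ht0.ne'] at h
    have h3 : |b L| ≤ B n := le_max_left _ _
    calc |b t| ≤ C * |b L| := h
      _ ≤ C * B n := by gcongr
      _ ≤ (2 + C) * B n := by nlinarith [hB0 n]
  have hβ : 1 / (a n - 1) ≤ (2 + C) * B n := by
    have : 1 / (a n - 1) ≤ 2 * (1 / L) := by
      rw [mul_one_div, div_le_div_iff₀ (by linarith) hL0]
      linarith
    nlinarith [hB0 n, mul_nonneg hC (hB0 n)]
  have hD : a n * hillNorm n (m n) = m n * (1 + ε n) := by
    simp only [ε]; field_simp; ring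
  have hmain := measure_estimator_sub_le (n := n) (c := c n) hm1 hθ (τ n) (by linarith) hτn
    (fun t ht s hs hs2 => hT₁ t (by linarith [(hT t ht).1]) s hs hs2) hb hβ hD hε
    (le_of_eq (by simp only [c, r]; ring)) hδ
  have hsq : 2 * (m n : ℝ) / (a n - 1) ^ 2 ≤ 8 * (r n * (1 / L)) ^ 2 := by
    have hr2 : r n ^ 2 = m n + 1 := by
      simp only [r]; rw [Real.sq_sqrt (by positivity)]; push_cast; ring
    calc 2 * (m n : ℝ) / (a n - 1) ^ 2 ≤ 2 * (m n + 1) / (L / 2) ^ 2 := by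
          gcongr <;> linarith
      _ = 8 * (r n * (1 / L)) ^ 2 := by rw [mul_pow, hr2]; field_simp; norm_num
  have hset : MeasurableSet {q : ℝ × (Fin (m n) → ℝ) |
      δ ≤ |√((m n + 1 : ℕ) : ℝ) * (pivotLogExcess (invFailureRate F) q.1 q.2 /
        hillNorm n (m n) - θ) - (√(m n : ℝ))⁻¹ * (θ * ∑ j, q.2 j - m n * θ)|} := by
    have := measurable_pivot_estimator (measurable_invFailureRate hF) (m n) √((m n + 1 : ℕ) : ℝ)
      (hillNorm n (m n)) θ
    refine measurableSet_le measurable_const (continuous_abs.measurable.comp ?_)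
    fun_prop
  rw [← (measurePreserving_pivot_excesses τ n (m n)).measure_preimage hset.nullMeasurableSet]
    at hmain
  refine le_trans (measure_mono fun ω hω => ?_) (hmain.trans ?_)
  · simp only [Pi.sub_apply, Pi.zero_apply, sub_zero, Real.norm_eq_abs, Set.mem_ofPred_eq,
      ← Finset.mul_sum, Finset.sum_range] at hω
    exact hω
  · gcongr

theorem tendstoInDistribution_hillEstimator {Ω : Type*} [MeasurableSpace Ω] (P : Measure Ω)
    [IsProbabilityMeasure P]
    (X : ℕ → Ω → ℝ) (hXmeas : ∀ i, Measurable (X i)) (hXindep : iIndepFun X P)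
    (F : ℝ → ℝ) (hF : ∀ i x, P.real {ω | X i ω ≤ x} = F x)
    (θ : ℝ) (hθ : 0 < θ) (ℓ : ℝ → ℝ) (hA1 : FirstOrder F θ ℓ)
    (ρ : ℝ) (b : ℝ → ℝ) (hA2 : SecondOrder ℓ b ρ)
    (k : ℕ → ℕ) (hk : Tendsto k atTop atTop)
    (hkn : Tendsto (fun n : ℕ => (k n : ℝ) / (n : ℝ)) atTop (𝓝 0))
    (hkb : Tendsto (fun n : ℕ => √(k n : ℝ) *
      max |b (Real.log (n : ℝ))| (1 / Real.log (n : ℝ))) atTop (𝓝 0)) :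
    TendstoInDistribution
      (fun (n : ℕ) (ω : Ω) =>
        √(k n : ℝ) * (hillEstimator (fun i => X i ω) n (k n) - θ))
      atTop (id : ℝ → ℝ) (fun _ => P) (gaussianReal 0 (θ ^ 2).toNNReal) := by
  have hprob : IsProbabilityMeasure (P.map (X 0)) :=
    Measure.isProbabilityMeasure_map (hXmeas 0).aemeasurable
  have hFX : ∀ x, (P.map (X 0)).real (Set.Iic x) = F x := fun x => by
    rw [map_measureReal_apply (hXmeas 0) measurableSet_Iic]
    exact hF 0 x
  obtain ⟨m, hmk⟩ : ∃ m : ℕ → ℕ, ∀ n, m n = k n - 1 := ⟨_, fun _ => rfl⟩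
  have hm : Tendsto m atTop atTop :=
    ((tendsto_sub_atTop_nat 1).comp hk).congr fun n => (hmk n).symm
  have hkm : ∀ᶠ n in atTop, k n = m n + 1 := by
    filter_upwards [hk.eventually_ge_atTop 1] with n hn
    have := hmk n
    omega
  have hkle : ∀ᶠ n in atTop, k n ≤ n := by
    filter_upwards [hkn.eventually (eventually_le_nhds one_pos), eventually_ge_atTop 1] with n h1 h2
    have h3 : (0 : ℝ) < n := by exact_mod_cast h2
    rw [div_le_one h3] at h1
    exact_mod_cast h1
  have hmb : Tendsto (fun n : ℕ => √((m n + 1 : ℕ) : ℝ) *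
      max |b (Real.log (n : ℝ))| (1 / Real.log (n : ℝ))) atTop (𝓝 0) := by
    refine hkb.congr' ?_
    filter_upwards [hkm] with n hn
    rw [← hn]
  -- a common sequence of pivot laws; the choice is immaterial for the finitely many `n` for which
  -- `m n + 1 ≤ n` fails
  have hex : ∀ n, ∃ τ : Measure ℝ, IsProbabilityMeasure τ ∧ (m n + 1 ≤ n →
      (1 ≤ Real.log ((n : ℝ) / (m n + 1)) →
        τ {t | 1 < |t - Real.log ((n : ℝ) / (m n + 1))|} ≤ ENNReal.ofReal (2 / (m n + 1))) ∧
      P.map (fun ω => √((m n + 1 : ℕ) : ℝ) *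
          (hillEstimator (fun i => X i ω) n (m n + 1) - θ)) =
        (τ.prod (Measure.pi fun _ : Fin (m n) => expMeasure 1)).map
          (fun q => √((m n + 1 : ℕ) : ℝ) *
            (pivotLogExcess (invFailureRate F) q.1 q.2 / hillNorm n (m n) - θ))) := by
    intro n
    by_cases hn : m n + 1 ≤ n
    · obtain ⟨τ, hτ, h⟩ := exists_law_hillEstimator hXmeas hXindep hF
        (Nat.add_sub_of_le hn).symm (√((m n + 1 : ℕ) : ℝ)) θ
      exact ⟨τ, hτ, fun _ => h⟩
    · exact ⟨Measure.dirac 0, inferInstance, fun h => absurd h hn⟩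
  choose τ hτ hτm using hex
  have hle : ∀ᶠ n in atTop, m n + 1 ≤ n := by
    filter_upwards [hkm, hkle] with n h1 h2
    omega
  have hlevel : ∀ᶠ n : ℕ in atTop, 1 ≤ Real.log ((n : ℝ) / (m n + 1)) := by
    have hinv : Tendsto (fun n : ℕ => ((m n : ℝ) + 1) / n) atTop (𝓝 0) := by
      refine hkn.congr' ?_
      filter_upwards [hkm] with n hn
      rw [hn]; push_cast; rfl
    filter_upwards [hinv.eventually (eventually_le_nhds (Real.exp_pos (-1))),
      eventually_ge_atTop 1] with n h1 h2
    have h3 : (0 : ℝ) < n := by exact_mod_cast h2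
    rw [← inv_div, Real.log_inv, le_neg, Real.log_le_iff_le_exp (by positivity)]
    exact h1
  have hZW := tendstoInMeasure_estimator_sub hFX hθ hA1 hA2 hm hmb τ (by
    filter_upwards [hle, hlevel] with n h1 h2
    have h := (hτm n h1).1 h2
    push_cast
    exact h)
  set Q := (Measure.infinitePi τ).prod (Measure.infinitePi fun _ : ℕ => expMeasure 1)
  have hclt := tendstoInDistribution_exponential_sum θ
  have hW : TendstoInDistribution (fun (n : ℕ) (ω : (ℕ → ℝ) × (ℕ → ℝ)) =>
      (√(m n : ℝ))⁻¹ * (∑ j ∈ Finset.range (m n), θ * ω.2 j - m n * θ)) atTop (id : ℝ → ℝ)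
      (fun _ => Q) (gaussianReal 0 (θ ^ 2).toNNReal) := by
    have hcltm : TendstoInDistribution (fun (n : ℕ) (x : ℕ → ℝ) =>
        (√(m n : ℝ))⁻¹ * (∑ j ∈ Finset.range (m n), θ * x j - m n * θ)) atTop (id : ℝ → ℝ)
        (fun _ => Measure.infinitePi fun _ : ℕ => expMeasure 1)
        (gaussianReal 0 (θ ^ 2).toNNReal) :=
      ⟨fun n => hclt.forall_aemeasurable (m n), hclt.aemeasurable_limit, hclt.tendsto.comp hm⟩
    refine tendstoInDistribution_of_eventually_map_eq (fun n => by fun_prop) hcltm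
      (.of_forall fun n => ?_)
    have hsnd : MeasurePreserving Prod.snd Q (Measure.infinitePi fun _ : ℕ => expMeasure 1) :=
      measurePreserving_snd
    conv_rhs => rw [← hsnd.map_eq]
    rw [Measure.map_map (by fun_prop) measurable_snd]
    rfl
  have hZ := tendstoInDistribution_of_tendstoInMeasure_sub _ _ hW hZW
    fun n => (measurable_pivot_estimator_comp (measurable_invFailureRate hFX) n (m n) _ _
      θ).aemeasurable
  have hmeas : ∀ n, AEMeasurable (fun ω => √(k n : ℝ) *
      (hillEstimator (fun i => X i ω) n (k n) - θ)) P := fun n => by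
    exact (((measurable_hillEstimator hXmeas n (k n)).sub_const θ).const_mul _).aemeasurable
  refine tendstoInDistribution_of_eventually_map_eq hmeas hZ ?_
  filter_upwards [hkm, hle] with n h1 h2
  rw [h1, (hτm n h2).2]
  exact map_pivot_estimator τ (measurable_invFailureRate hFX) n (m n) _ _ θ

end WeibullTail

theorem corollary1 {Ω : Type*} [MeasurableSpace Ω] (P : Measure Ω) [IsProbabilityMeasure P]
    (X : ℕ → Ω → ℝ) (hXmeas : ∀ i, Measurable (X i)) (hXindep : iIndepFun X P)
    (F : ℝ → ℝ) (hF : ∀ i x, P.real {ω | X i ω ≤ x} = F x)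
    (θ : ℝ) (hθ : 0 < θ) (ℓ : ℝ → ℝ) (hA1 : WeibullTail.FirstOrder F θ ℓ)
    (ρ : ℝ) (b : ℝ → ℝ) (hA2 : WeibullTail.SecondOrder ℓ b ρ)
    (k : ℕ → ℕ) (hk : Tendsto k atTop atTop)
    (hkn : Tendsto (fun n : ℕ => (k n : ℝ) / (n : ℝ)) atTop (𝓝 0))
    (hkb : Tendsto (fun n : ℕ => √(k n : ℝ) *
      max |b (Real.log (n : ℝ))| (1 / Real.log (n : ℝ))) atTop (𝓝 0)) :
    TendstoInDistribution
      (fun (n : ℕ) (ω : Ω) =>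
        √(k n : ℝ) * (WeibullTail.hillEstimator (fun i => X i ω) n (k n) - θ))
      atTop (id : ℝ → ℝ) (fun _ => P) (gaussianReal 0 (θ ^ 2).toNNReal) :=
  WeibullTail.tendstoInDistribution_hillEstimator P X hXmeas hXindep F hF θ hθ ℓ hA1 ρ b hA2 k hk
    hkn hkb
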